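/- Let $r\in(0,1)$ and let $m\ge 2$ be an integer. Let $\mu_0$ be area measure (planar Lebesgue measure) restricted to the region $G_{r,m}=\{z\in\mathbb{C}:|z^m-1|<r^m\}$, let $\{\varphi_n(z;\mu_0)\}_{n\ge0}$ be the orthonormal polynomials of $\mu_0$ ($\varphi_n$ has degree $n$ and positive leading coefficient, and $\int\varphi_n\overline{\varphi_j}\,d\mu_0=\delta_{n,j}$), and let $\kappa_n(\mu_0)$ be the leading coefficient of $\varphi_n(z;\mu_0)$. Let $s\in\{0,1,\ldots,m-2\}$ and put $v=2-\frac{2}{m}-\frac{2s}{m}$. Then $$\kappa_{km+s}(\mu_0)^2=\frac{(mk+1+s)\left(1+\frac{v}{2k}\right)}{\pi r^{2km+2m}}\left(1+\mathcal{O}(k^{-2})\right)\qquad\text{as }k\to\infty,$$ where the constant implied in $\mathcal{O}(k^{-2})$ may depend on $r$, $m$ and $s$. -/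

import Mathlib

open Filter Asymptotics MeasureTheory Polynomial

noncomputable section

namespace OrthPoly

/-- The inner product `⟨P, Q⟩ = ∫ P(z) conj(Q(z)) dμ(z)` of polynomials in `L²(μ)`. -/
def polyInner (μ : Measure ℂ) (P Q : ℂ[X]) : ℂ :=
  ∫ z, P.eval z * (starRingEnd ℂ) (Q.eval z) ∂μ

/-- The monic orthogonal polynomial `Φ_n(z; μ)` of degree `n`: Gram–Schmidt orthogonalization
of the monomials `1, z, z², …` in `L²(μ)`. -/
def monicOrthPoly (μ : Measure ℂ) (n : ℕ) : ℂ[X] :=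
  X ^ n - ∑ j : Fin n,
    C (polyInner μ (X ^ n) (monicOrthPoly μ j.1) /
        polyInner μ (monicOrthPoly μ j.1) (monicOrthPoly μ j.1)) * monicOrthPoly μ j.1
termination_by n
decreasing_by all_goals exact j.2

/-- The orthonormal polynomial `φ_n(z; μ) = Φ_n(z; μ) / ‖Φ_n(·; μ)‖` in `L²(μ)`; it has degree `n`
and positive leading coefficient. -/
def orthonormalPoly (μ : Measure ℂ) (n : ℕ) : ℂ[X] :=
  C (((Real.sqrt (∫ z, ‖(monicOrthPoly μ n).eval z‖ ^ 2 ∂μ))⁻¹ : ℝ) : ℂ) * monicOrthPoly μ n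

/-- The leading coefficient `κ_n(μ)` of the orthonormal polynomial `φ_n(z; μ)`. -/
def kappa (μ : Measure ℂ) (n : ℕ) : ℂ :=
  (orthonormalPoly μ n).leadingCoeff

/-- The region `G_{r,m} = {z : |z^m - 1| < r^m}` bounded by a polynomial lemniscate. -/
def lemniscateRegion (r : ℝ) (m : ℕ) : Set ℂ :=
  {z : ℂ | ‖z ^ m - 1‖ < r ^ m}

/-- Area measure (planar Lebesgue measure) on `G_{r,m}`. -/
def lemniscateArea (r : ℝ) (m : ℕ) : Measure ℂ :=
  volume.restrict (lemniscateRegion r m)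

end OrthPoly

end

namespace OrthPoly

open Metric

/-! The number `κ_n ^ (-2)` is the least squared norm `∫ |P|²` over monic `P` of degree `n`, so the
theorem is a two-sided estimate of this minimum for `n = km + s`.

Put `ρ = r ^ m`. The region is the disjoint union of the images of the unit disc under the `m`
branches `z = ζ^j (1 + ρu)^(1/m)` (`integral_lemniscateArea`). Averaging over rotations reduces the
problem to `P = z^s Q(z^m)`. The Jacobian and `|z|^(2s)` then combine into one weight, and it
remains to minimise `∫ |(1 + ρu)^(-a) q(u)|²` over the disc, where `a = 1 - 1/m - s/m = v/2`, for
`q` of degree `k` with leading coefficient `ρ^k`.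

Lower bound: `u^k (1 + ρu)^(-a)` is `u^k` plus higher powers, so pairing `q` with it sees only the
leading coefficient `b` of `q`. Since only the modulus of the weight matters, it may be moved across
as a conjugate, and the minimum is at least `b² π/(k+1)`.

Upper bound: take for `q / b` the polynomial part of `u^k (1 + ρ/u)^a`. The Taylor coefficients `e`
of its product with the weight, indexed by `N = n - k`, concentrate near `N = 0`. Expanding `1/(N +
k + 1)` around `N = 0`, one needs the total mass and the first moment of `e²`. A reflection relates
both to sequences `η`, `ζ` built from the product of a truncated series with its inverse, for which
`η` is a delta up to an exponentially small tail. Both bounds thus agree up to a factor `1 +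
O(k^(-2))` (`exists_tsum_sq_div_le`).

Finally `(k + 1 - a)(1 + a/k) = k + 1 + a(1 - a)/k`, so the factor with `v` turns `mk + 1 + s = m(k
+ 1 - a)` into `m(k + 1)` up to relative order `k^(-2)`. -/

theorem summable_abs_pow_mul_pow_natAbs {ρ : ℝ} (h0 : 0 ≤ ρ) (h1 : ρ < 1) (p : ℕ) :
    Summable fun N : ℤ => |(N : ℝ)| ^ p * ρ ^ N.natAbs := by
  have h : Summable fun n : ℕ => (n : ℝ) ^ p * ρ ^ n :=
    summable_pow_mul_geometric_of_norm_lt_one p (by rwa [Real.norm_of_nonneg h0])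
  refine Summable.of_nat_of_neg ?_ ?_ <;> simpa using h

theorem tsum_mul_sum_mul_sum {w : ℤ → ℝ} {f g : ℕ → ℤ → ℝ} (s : Finset ℕ) (a b : ℕ → ℝ)
    (h : ∀ i j, Summable fun N => w N * f i N * g j N) :
    ∑' N, w N * (∑ i ∈ s, a i * f i N) * (∑ j ∈ s, b j * g j N) =
      ∑ i ∈ s, ∑ j ∈ s, a i * b j * ∑' N, w N * f i N * g j N := by
  have e : ∀ N, w N * (∑ i ∈ s, a i * f i N) * (∑ j ∈ s, b j * g j N) =
      ∑ i ∈ s, ∑ j ∈ s, a i * b j * (w N * f i N * g j N) := by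
    intro N
    rw [mul_assoc, Finset.sum_mul_sum, Finset.mul_sum]
    refine Finset.sum_congr rfl fun i _ => ?_
    rw [Finset.mul_sum]
    exact Finset.sum_congr rfl fun j _ => by ring
  simp_rw [e]
  rw [Summable.tsum_finsetSum fun i _ => summable_sum fun j _ => (h i j).mul_left _]
  refine Finset.sum_congr rfl fun i _ => ?_
  rw [Summable.tsum_finsetSum fun j _ => (h i j).mul_left _]
  exact Finset.sum_congr rfl fun j _ => tsum_mul_left

/-! ### Correlations of translates on ℤ and their reflection -/

section Reflection

variable {d : ℤ → ℝ} {ρ : ℝ}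

theorem summable_shift_mul_shift (h0 : 0 ≤ ρ) (h1 : ρ < 1) (hd : ∀ N, |d N| ≤ ρ ^ N.natAbs)
    (i j : ℤ) : Summable fun N => d (N + i) * d (N + j) := by
  have h := (Equiv.addRight i).summable_iff.mpr (summable_abs_pow_mul_pow_natAbs h0 h1 0)
  refine Summable.of_norm_bounded h fun N => ?_
  simp only [Function.comp, Equiv.coe_addRight, pow_zero, one_mul, norm_mul, Real.norm_eq_abs]
  calc _ ≤ ρ ^ (N + i).natAbs * 1 :=
        mul_le_mul (hd _) ((hd _).trans (pow_le_one₀ h0 h1.le)) (abs_nonneg _) (by positivity)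
    _ = _ := mul_one _

theorem summable_id_mul_shift_mul_shift (h0 : 0 ≤ ρ) (h1 : ρ < 1)
    (hd : ∀ N, |d N| ≤ ρ ^ N.natAbs) (i j : ℤ) :
    Summable fun N : ℤ => (N : ℝ) * d (N + i) * d (N + j) := by
  have h : Summable fun N : ℤ => ((N + i : ℤ) : ℝ) * d (N + i) * d (N + j) := by
    have h := (Equiv.addRight i).summable_iff.mpr (summable_abs_pow_mul_pow_natAbs h0 h1 1)
    refine Summable.of_norm_bounded h fun N => ?_
    simp only [Function.comp, Equiv.coe_addRight, pow_one, norm_mul, Real.norm_eq_abs]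
    calc _ ≤ |((N + i : ℤ) : ℝ)| * ρ ^ (N + i).natAbs * 1 :=
          mul_le_mul (mul_le_mul_of_nonneg_left (hd _) (abs_nonneg _))
            ((hd _).trans (pow_le_one₀ h0 h1.le)) (abs_nonneg _) (by positivity)
      _ = _ := mul_one _
  refine (h.sub ((summable_shift_mul_shift h0 h1 hd i j).mul_left (i : ℝ))).congr fun N => ?_
  push_cast
  ring

/-- Reflection `N ↦ -N` of the translates does not change correlations. -/
theorem tsum_sum_shift_mul_sum_shift (h0 : 0 ≤ ρ) (h1 : ρ < 1) (hd : ∀ N, |d N| ≤ ρ ^ N.natAbs)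
    (s : Finset ℕ) (a b : ℕ → ℝ) :
    ∑' N : ℤ, (∑ i ∈ s, a i * d (N + i)) * (∑ j ∈ s, b j * d (N + j)) =
      ∑' N : ℤ, (∑ i ∈ s, a i * d (N - i)) * (∑ j ∈ s, b j * d (N - j)) := by
  have A := tsum_mul_sum_mul_sum (w := fun _ => 1) (f := fun i N => d (N + i))
    (g := fun i N => d (N + i)) s a b
    (fun i j => by simpa using summable_shift_mul_shift h0 h1 hd i j)
  have B := tsum_mul_sum_mul_sum (w := fun _ => 1) (f := fun i N => d (N - i))
    (g := fun i N => d (N - i)) s a b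
    (fun i j => by simpa [sub_eq_add_neg] using summable_shift_mul_shift h0 h1 hd (-i) (-j))
  simp only [one_mul] at A B
  rw [A, B]
  refine Finset.sum_congr rfl fun i _ => Finset.sum_congr rfl fun j _ => ?_
  congr 1
  -- Translation by `i + j` sends `N - i`, `N - j` to `N + j`, `N + i`, so it exchanges the two
  -- factors.
  rw [← (Equiv.addRight ((i : ℤ) + j)).tsum_eq fun N : ℤ => d (N - i) * d (N - j)]
  refine tsum_congr fun N => ?_
  simp only [Equiv.coe_addRight]
  rw [show N + ((i : ℤ) + j) - i = N + j by ring, show N + ((i : ℤ) + j) - j = N + i by ring,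
    mul_comm]

/-- The translation by `i + j` that performs the reflection turns the weight `N` into `N + i + j`.
By symmetry in `i` and `j`, the excess `i + j` contributes twice the sum weighted by `i` alone. -/
theorem tsum_id_mul_sum_shift_sq (h0 : 0 ≤ ρ) (h1 : ρ < 1) (hd : ∀ N, |d N| ≤ ρ ^ N.natAbs)
    (s : Finset ℕ) (c : ℕ → ℝ) :
    ∑' N : ℤ, (N : ℝ) * (∑ i ∈ s, c i * d (N - i)) * (∑ j ∈ s, c j * d (N - j)) =
      ∑' N : ℤ, (N : ℝ) * (∑ i ∈ s, c i * d (N + i)) * (∑ j ∈ s, c j * d (N + j)) +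
      2 * ∑' N : ℤ, (∑ i ∈ s, (i * c i) * d (N - i)) * (∑ j ∈ s, c j * d (N - j)) := by
  rw [← tsum_sum_shift_mul_sum_shift h0 h1 hd]
  have A := tsum_mul_sum_mul_sum (w := fun N : ℤ => (N : ℝ)) (f := fun i N => d (N + i))
    (g := fun i N => d (N + i)) s c c
    (fun i j => summable_id_mul_shift_mul_shift h0 h1 hd i j)
  have B := tsum_mul_sum_mul_sum (w := fun N : ℤ => (N : ℝ)) (f := fun i N => d (N - i))
    (g := fun i N => d (N - i)) s c c
    (fun i j => by simpa [sub_eq_add_neg] using summable_id_mul_shift_mul_shift h0 h1 hd (-i) (-j))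
  have D := tsum_mul_sum_mul_sum (w := fun _ => 1) (f := fun i N => d (N + i))
    (g := fun i N => d (N + i)) s (fun i => i * c i) c
    (fun i j => by simpa using summable_shift_mul_shift h0 h1 hd i j)
  simp only [one_mul] at D
  rw [A, B, D]
  have key : ∀ i j : ℕ, ∑' N : ℤ, (N : ℝ) * d (N - i) * d (N - j) =
      ∑' N : ℤ, (N : ℝ) * d (N + i) * d (N + j) + (i + j) * ∑' N : ℤ, d (N + i) * d (N + j) := by
    intro i j
    rw [← (Equiv.addRight ((i : ℤ) + j)).tsum_eq fun N : ℤ => (N : ℝ) * d (N - i) * d (N - j),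
      ← tsum_mul_left, ← Summable.tsum_add (summable_id_mul_shift_mul_shift h0 h1 hd i j)
        ((summable_shift_mul_shift h0 h1 hd i j).mul_left _)]
    refine tsum_congr fun N => ?_
    simp only [Equiv.coe_addRight]
    rw [show N + ((i : ℤ) + j) - i = N + j by ring, show N + ((i : ℤ) + j) - j = N + i by ring]
    push_cast
    ring
  have sym : ∑ i ∈ s, ∑ j ∈ s, j * c i * c j * ∑' N : ℤ, d (N + i) * d (N + j) =
      ∑ i ∈ s, ∑ j ∈ s, i * c i * c j * ∑' N : ℤ, d (N + i) * d (N + j) := by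
    rw [Finset.sum_comm]
    refine Finset.sum_congr rfl fun i _ => Finset.sum_congr rfl fun j _ => ?_
    rw [tsum_congr fun N : ℤ => mul_comm (d (N + j)) (d (N + i))]
    ring
  rw [two_mul]
  nth_rewrite 1 [← sym]
  simp_rw [← Finset.sum_add_distrib]
  refine Finset.sum_congr rfl fun i _ => Finset.sum_congr rfl fun j _ => ?_
  rw [key]
  ring

end Reflection

/-! ### The weighted ℓ² estimate -/

/-- The exact remainder of the first-order expansion is `x² / (K² (K + x))`, and `K / (K + x) ≤ 1 +
|x|` because `K + x ≥ 1`. Polynomial growth in `x` is harmless against exponentially decaying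
sequences. -/
theorem inv_add_le_quadratic {K x : ℝ} (hK : 1 ≤ K) (hx : 1 ≤ K + x) :
    (K + x)⁻¹ ≤ 1 / K - x / K ^ 2 + (|x| ^ 2 + |x| ^ 3) / K ^ 3 := by
  have hK0 : 0 < K := by linarith
  have hx0 : 0 < K + x := by linarith
  have h1 : K * (K + x)⁻¹ ≤ 1 + |x| := by
    rw [← div_eq_mul_inv, div_le_iff₀ hx0]
    rcases le_or_gt 0 x with h | h
    · rw [abs_of_nonneg h]; nlinarith
    · rw [abs_of_neg h]; nlinarith
  have h2 : (K + x)⁻¹ = 1 / K - x / K ^ 2 + x ^ 2 * (K * (K + x)⁻¹) / K ^ 3 := by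
    field_simp
    ring
  rw [h2]
  gcongr
  calc x ^ 2 * (K * (K + x)⁻¹) ≤ x ^ 2 * (1 + |x|) := by gcongr
    _ = |x| ^ 2 + |x| ^ 3 := by rw [← sq_abs]; ring

section Bounds

variable {c : ℕ → ℝ} {d : ℤ → ℝ} {ρ : ℝ}

/-- Since `2j + 2|N + j| ≥ |N| + j`, giving up half of the decay rate leaves a geometric series in
`j`, hence a bound uniform in `k`. -/
theorem abs_sum_shift_le {σ : ℝ} (h0 : 0 < σ) (h1 : σ < 1) (hc : ∀ j, |c j| ≤ (σ ^ 2) ^ j)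
    (hd : ∀ N, |d N| ≤ (σ ^ 2) ^ N.natAbs) (k : ℕ) (N : ℤ) :
    |∑ j ∈ Finset.range (k + 1), c j * d (N + j)| ≤ σ ^ N.natAbs * (1 - σ)⁻¹ := by
  calc _ ≤ ∑ j ∈ Finset.range (k + 1), |c j * d (N + j)| := Finset.abs_sum_le_sum_abs _ _
    _ ≤ ∑ j ∈ Finset.range (k + 1), σ ^ N.natAbs * σ ^ j := by
        refine Finset.sum_le_sum fun j _ => ?_
        rw [abs_mul]
        calc |c j| * |d (N + j)| ≤ (σ ^ 2) ^ j * (σ ^ 2) ^ (N + j).natAbs :=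
              mul_le_mul (hc _) (hd _) (abs_nonneg _) (by positivity)
          _ = σ ^ (2 * j + 2 * (N + j).natAbs) := by rw [pow_add, pow_mul, pow_mul]
          _ ≤ σ ^ (N.natAbs + j) := pow_le_pow_of_le_one h0.le h1.le (by omega)
          _ = _ := pow_add _ _ _
    _ = σ ^ N.natAbs * ∑ j ∈ Finset.range (k + 1), σ ^ j := by rw [Finset.mul_sum]
    _ ≤ _ := by
        gcongr
        rw [← tsum_geometric_of_lt_one h0.le h1]
        exact (summable_geometric_of_lt_one h0.le h1).sum_le_tsum _ fun _ _ => by positivity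

/-- For `j ≤ k ≤ N` the decay rates add up exactly to `ρ^N`, so every one of the `k + 1` terms has
the same bound. -/
theorem abs_sum_reflect_le {B : ℝ} {b : ℕ → ℝ} {k : ℕ}
    (hb : ∀ j ≤ k, |b j| ≤ B * ρ ^ j)
    (hd : ∀ N, |d N| ≤ ρ ^ N.natAbs) {N : ℤ} (hN : (k : ℤ) ≤ N) :
    |∑ j ∈ Finset.range (k + 1), b j * d (N - j)| ≤ (k + 1) * B * ρ ^ N.natAbs := by
  calc _ ≤ ∑ j ∈ Finset.range (k + 1), |b j * d (N - j)| := Finset.abs_sum_le_sum_abs _ _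
    _ ≤ ∑ j ∈ Finset.range (k + 1), B * ρ ^ N.natAbs := by
        refine Finset.sum_le_sum fun j hj => ?_
        rw [Finset.mem_range] at hj
        have hB := hb j (by omega)
        rw [abs_mul]
        calc |b j| * |d (N - j)| ≤ (B * ρ ^ j) * ρ ^ (N - j).natAbs :=
              mul_le_mul hB (hd _) (abs_nonneg _) ((abs_nonneg _).trans hB)
          _ = B * ρ ^ (j + (N - j).natAbs) := by rw [pow_add, mul_assoc]
          _ = _ := by congr 2; omega
    _ = _ := by simp; ring

/-- Partial sums of a convolution inverse annihilate the coefficients `1, …, k`. -/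
theorem sum_reflect_eq_ite (c0 : c 0 = 1) (d0 : d 0 = 1) (dneg : ∀ N < 0, d N = 0)
    (conv : ∀ n : ℕ, 1 ≤ n → ∑ j ∈ Finset.range (n + 1), c j * d (n - j) = 0)
    {k : ℕ} {N : ℤ} (hN : N ≤ k) :
    ∑ j ∈ Finset.range (k + 1), c j * d (N - j) = if N = 0 then 1 else 0 := by
  rcases lt_or_ge N 0 with h | h
  · rw [if_neg (by omega)]
    exact Finset.sum_eq_zero fun j _ => by rw [dneg _ (by omega), mul_zero]
  · lift N to ℕ using h
    -- As `d` vanishes on negative indices, the truncation at `k ≥ N` does not affect the full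
    -- convolution.
    have hsub : Finset.range (N + 1) ⊆ Finset.range (k + 1) := Finset.range_mono (by omega)
    rw [← Finset.sum_subset hsub fun j _ hj => by
      rw [Finset.mem_range] at hj; rw [dneg _ (by omega), mul_zero]]
    rcases Nat.eq_zero_or_pos N with rfl | h
    · simp [c0, d0]
    · rw [conv N h, if_neg (by omega)]

/-- The weighted `ℓ²` bound behind the upper estimate of the Bergman extremal problem. -/
theorem exists_tsum_sq_div_le (h0 : 0 < ρ) (h1 : ρ < 1) (hc : ∀ j, |c j| ≤ ρ ^ j)
    (hd : ∀ N, |d N| ≤ ρ ^ N.natAbs) (c0 : c 0 = 1) (d0 : d 0 = 1) (dneg : ∀ N < 0, d N = 0)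
    (conv : ∀ n : ℕ, 1 ≤ n → ∑ j ∈ Finset.range (n + 1), c j * d (n - j) = 0) :
    ∃ A : ℝ, 0 ≤ A ∧ ∀ k : ℕ,
      ∑' n : ℕ, (∑ j ∈ Finset.range (k + 1), c j * d ((n : ℤ) - k + j)) ^ 2 / ((n : ℝ) + 1) ≤
        1 / ((k : ℝ) + 1) + A / ((k : ℝ) + 1) ^ 3 := by
  set σ := √ρ with hσ
  have σ0 : 0 < σ := Real.sqrt_pos.mpr h0
  have σ1 : σ < 1 := by rw [hσ, Real.sqrt_lt' one_pos]; simpa using h1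
  have σsq : σ ^ 2 = ρ := Real.sq_sqrt h0.le
  have hs4 := summable_abs_pow_mul_pow_natAbs h0.le h1 4
  have hsp := fun p => summable_abs_pow_mul_pow_natAbs h0.le h1 p
  set M := ∑' N : ℤ, |(N : ℝ)| ^ 4 * ρ ^ N.natAbs with hM
  set L := ∑' N : ℤ, (|(N : ℝ)| ^ 2 + |(N : ℝ)| ^ 3) * ρ ^ N.natAbs with hL
  have hM0 : 0 ≤ M := tsum_nonneg fun N => by positivity
  have hL0 : 0 ≤ L := tsum_nonneg fun N => by positivity
  have hsL : Summable fun N : ℤ => (|(N : ℝ)| ^ 2 + |(N : ℝ)| ^ 3) * ρ ^ N.natAbs :=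
    ((hsp 2).add (hsp 3)).congr fun N => by ring
  set B := ((1 - σ)⁻¹) ^ 2 with hB
  -- The three terms come from the mass `∑ e²`, the first moment `∑ N e²` and the remainder of the
  -- expansion of `1 / (N + K)`.
  refine ⟨M + 2 * M + B * L, by positivity, fun k => ?_⟩
  set K : ℝ := (k : ℝ) + 1 with hK
  have hK1 : 1 ≤ K := by simp [hK]
  have hK0 : 0 < K := by linarith
  -- With `N = n - k` the denominator `n + 1` is `N + K`. The sequence `η` is the reflection of `e`,
  -- and `ζ` is the extra factor that the first moment produces under reflection.
  set e : ℤ → ℝ := fun N => ∑ j ∈ Finset.range (k + 1), c j * d (N + j) with he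
  set η : ℤ → ℝ := fun N => ∑ j ∈ Finset.range (k + 1), c j * d (N - j) with hη
  set ζ : ℤ → ℝ := fun N => ∑ j ∈ Finset.range (k + 1), (j * c j) * d (N - j) with hζ
  have e_sq : ∀ N, e N ^ 2 ≤ B * ρ ^ N.natAbs := by
    intro N
    have := abs_sum_shift_le σ0 σ1 (by rwa [σsq]) (by rwa [σsq]) k N
    calc e N ^ 2 = |e N| ^ 2 := (sq_abs _).symm
      _ ≤ (σ ^ N.natAbs * (1 - σ)⁻¹) ^ 2 := by gcongr
      _ = B * (σ ^ 2) ^ N.natAbs := by rw [hB]; ring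
      _ = _ := by rw [σsq]
  have e_zero : ∀ N : ℤ, (N : ℝ) + K < 1 → e N = 0 := by
    intro N hN
    have hN' : N + k < 0 := by
      rw [hK] at hN
      have : ((N + k : ℤ) : ℝ) < 0 := by push_cast; linarith
      exact_mod_cast this
    refine Finset.sum_eq_zero fun j hj => ?_
    rw [Finset.mem_range] at hj
    rw [dneg _ (by omega), mul_zero]
  have small : ∀ N : ℤ, N ≤ k → η N = if N = 0 then 1 else 0 := fun N hN =>
    sum_reflect_eq_ite c0 d0 dneg conv hN
  have large : ∀ N : ℤ, (k : ℤ) < N → K ≤ |(N : ℝ)| := by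
    intro N hN
    have : (k : ℤ) + 1 ≤ N := hN
    have : K ≤ (N : ℝ) := by rw [hK]; exact_mod_cast this
    exact this.trans (le_abs_self _)
  have η_le : ∀ N : ℤ, (k : ℤ) < N → |η N| ≤ K * ρ ^ N.natAbs := by
    intro N hN
    have := abs_sum_reflect_le (b := c) (B := 1) (fun j _ => by simpa using hc j) hd hN.le
    simpa [hK] using this
  have ζ_le : ∀ N : ℤ, (k : ℤ) < N → |ζ N| ≤ K * K * ρ ^ N.natAbs := by
    intro N hN
    refine abs_sum_reflect_le (b := fun j => j * c j) (B := K) (fun j hj => ?_) hd hN.le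
    rw [abs_mul, Nat.abs_cast]
    refine mul_le_mul ?_ (hc j) (abs_nonneg _) hK0.le
    have : (j : ℝ) ≤ k := by exact_mod_cast hj
    rw [hK]; linarith
  have ρ_sq : ∀ N : ℤ, ρ ^ N.natAbs * ρ ^ N.natAbs ≤ ρ ^ N.natAbs := fun N =>
    mul_le_of_le_one_right (by positivity) (pow_le_one₀ h0.le h1.le)
  -- Beyond `k` one has `K ≤ |N|`, so the loss of powers of `K` and the wanted gain `K^(-2)` are
  -- both paid for by `|N|^4`.
  have η_sq : ∀ N, η N ^ 2 ≤ (if N = 0 then 1 else 0) + |(N : ℝ)| ^ 4 * ρ ^ N.natAbs / K ^ 2 := by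
    intro N
    rcases le_or_gt N k with h | h
    · rw [small N h]
      have : 0 ≤ |(N : ℝ)| ^ 4 * ρ ^ N.natAbs / K ^ 2 := by positivity
      split_ifs <;> linarith
    · have hN := large N h
      rw [if_neg (by omega), zero_add, le_div_iff₀ (by positivity)]
      calc η N ^ 2 * K ^ 2 = |η N| ^ 2 * K ^ 2 := by rw [sq_abs]
        _ ≤ (K * ρ ^ N.natAbs) ^ 2 * K ^ 2 := by gcongr; exact η_le N h
        _ = K ^ 4 * (ρ ^ N.natAbs * ρ ^ N.natAbs) := by ring
        _ ≤ _ := by gcongr; exact ρ_sq N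
  have ζη : ∀ N, |ζ N * η N| ≤ |(N : ℝ)| ^ 4 * ρ ^ N.natAbs / K := by
    intro N
    have hp : 0 ≤ |(N : ℝ)| ^ 4 * ρ ^ N.natAbs / K := by positivity
    rcases le_or_gt N k with h | h
    · rw [small N h]
      split_ifs with h'
      · subst h'
        -- At `N = 0` only `j = 0` meets the support of `d`, and its weight `j` is zero.
        have : ζ 0 = 0 := by
          refine Finset.sum_eq_zero fun j _ => ?_
          rcases Nat.eq_zero_or_pos j with rfl | hj
          · simp
          · rw [dneg _ (by omega), mul_zero]
        simp [this]
      · simpa using hp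
    · have hN := large N h
      rw [le_div_iff₀ hK0, abs_mul]
      calc |ζ N| * |η N| * K ≤ (K * K * ρ ^ N.natAbs) * (K * ρ ^ N.natAbs) * K := by
            gcongr
            · exact ζ_le N h
            · exact η_le N h
        _ = K ^ 4 * (ρ ^ N.natAbs * ρ ^ N.natAbs) := by ring
        _ ≤ _ := by gcongr; exact ρ_sq N
  have s_e : Summable fun N => e N ^ 2 :=
    Summable.of_nonneg_of_le (fun _ => sq_nonneg _) e_sq
      ((by simpa using hsp 0 : Summable fun N : ℤ => ρ ^ N.natAbs).mul_left B)
  have s_Ne : Summable fun N : ℤ => (N : ℝ) * e N ^ 2 := by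
    refine Summable.of_norm_bounded ((hsp 1).mul_left B) fun N => ?_
    rw [norm_mul, Real.norm_eq_abs, Real.norm_of_nonneg (sq_nonneg _), pow_one]
    calc _ ≤ |(N : ℝ)| * (B * ρ ^ N.natAbs) := by gcongr; exact e_sq N
      _ = _ := by ring
  have Qe : ∀ N : ℤ, (|(N : ℝ)| ^ 2 + |(N : ℝ)| ^ 3) * e N ^ 2 ≤
      B * ((|(N : ℝ)| ^ 2 + |(N : ℝ)| ^ 3) * ρ ^ N.natAbs) := fun N => by
    calc _ ≤ (|(N : ℝ)| ^ 2 + |(N : ℝ)| ^ 3) * (B * ρ ^ N.natAbs) := by gcongr; exact e_sq N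
      _ = _ := by ring
  have s_Qe : Summable fun N : ℤ => (|(N : ℝ)| ^ 2 + |(N : ℝ)| ^ 3) * e N ^ 2 :=
    Summable.of_nonneg_of_le (fun _ => by positivity) Qe (hsL.mul_left B)
  have s_δ : Summable fun N : ℤ => if N = 0 then (1 : ℝ) else 0 :=
    (hasSum_ite_eq (0 : ℤ) (1 : ℝ)).summable
  have T0 : ∑' N, e N ^ 2 ≤ 1 + M / K ^ 2 := by
    have h := tsum_sum_shift_mul_sum_shift h0.le h1 hd (Finset.range (k + 1)) c c
    simp only [← sq] at h
    calc ∑' N, e N ^ 2 = ∑' N, η N ^ 2 := h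
      _ ≤ ∑' N : ℤ, ((if N = 0 then (1 : ℝ) else 0) + |(N : ℝ)| ^ 4 * ρ ^ N.natAbs / K ^ 2) := by
          have hs := s_δ.add (hs4.div_const (K ^ 2))
          exact Summable.tsum_le_tsum η_sq
            (Summable.of_nonneg_of_le (fun _ => sq_nonneg _) η_sq hs) hs
      _ = _ := by
          rw [Summable.tsum_add s_δ (hs4.div_const _), tsum_ite_eq, tsum_div_const]
  -- A lower bound suffices, because the first moment enters the expansion with a minus sign. The
  -- reflected moment `∑ N η²` is nonnegative since `η` vanishes for `N < 0`.
  have T1 : -(2 * (M / K)) ≤ ∑' N : ℤ, (N : ℝ) * e N ^ 2 := by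
    have h := tsum_id_mul_sum_shift_sq h0.le h1 hd (Finset.range (k + 1)) c
    simp only [mul_assoc (Int.cast _ : ℝ), ← sq] at h
    have h' : ∑' N : ℤ, (N : ℝ) * η N ^ 2 =
      ∑' N : ℤ, (N : ℝ) * e N ^ 2 + 2 * ∑' N : ℤ, ζ N * η N := h
    have p1 : 0 ≤ ∑' N : ℤ, (N : ℝ) * η N ^ 2 := by
      refine tsum_nonneg fun N => ?_
      rcases lt_or_ge N 0 with hN | hN
      · rw [small N (by omega), if_neg (by omega)]; simp
      · have : (0 : ℝ) ≤ N := by exact_mod_cast hN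
        positivity
    have p2 : ∑' N : ℤ, ζ N * η N ≤ M / K := by
      rw [hM, ← tsum_div_const]
      exact Summable.tsum_le_tsum (fun N => (le_abs_self _).trans (ζη N))
        (Summable.of_norm_bounded (hs4.div_const K) ζη) (hs4.div_const K)
    linarith
  have T2 : ∑' N : ℤ, (|(N : ℝ)| ^ 2 + |(N : ℝ)| ^ 3) * e N ^ 2 ≤ B * L := by
    rw [hL, ← tsum_mul_left]
    exact Summable.tsum_le_tsum Qe s_Qe (hsL.mul_left B)
  set g : ℤ → ℝ := fun N => e N ^ 2 / ((N : ℝ) + K) with hg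
  have g0 : ∀ N, 0 ≤ g N := by
    intro N
    rcases lt_or_ge ((N : ℝ) + K) 1 with h | h
    · simp [hg, e_zero N h]
    · exact div_nonneg (sq_nonneg _) (by linarith)
  have g_le : ∀ N : ℤ, g N ≤ 1 / K * e N ^ 2 - 1 / K ^ 2 * (N * e N ^ 2) +
      1 / K ^ 3 * ((|(N : ℝ)| ^ 2 + |(N : ℝ)| ^ 3) * e N ^ 2) := by
    intro N
    rcases lt_or_ge ((N : ℝ) + K) 1 with h | h
    · simp [hg, e_zero N h]
    · have := inv_add_le_quadratic hK1 (x := (N : ℝ)) (by linarith)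
      calc g N = e N ^ 2 * (K + N)⁻¹ := by simp only [hg, div_eq_mul_inv, add_comm K]
        _ ≤ e N ^ 2 * (1 / K - N / K ^ 2 + (|(N : ℝ)| ^ 2 + |(N : ℝ)| ^ 3) / K ^ 3) := by gcongr
        _ = _ := by ring
  have s_maj := ((s_e.mul_left (1 / K)).sub (s_Ne.mul_left (1 / K ^ 2))).add
    (s_Qe.mul_left (1 / K ^ 3))
  have s_g : Summable g := Summable.of_nonneg_of_le g0 g_le s_maj
  calc _ = ∑' n : ℕ, g ((n : ℤ) - k) := by
        refine tsum_congr fun n => ?_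
        simp only [hg, he]
        congr 1
        rw [hK]; push_cast; ring
    -- The indices `N ≥ -k` are enlarged to all of ℤ at no cost, as `g ≥ 0`.
    _ ≤ ∑' N, g N := tsum_comp_le_tsum_of_inj s_g g0
          (i := fun n : ℕ => (n : ℤ) - k) (fun a b h => by simpa using h)
    _ ≤ _ := Summable.tsum_le_tsum g_le s_g s_maj
    _ = 1 / K * ∑' N, e N ^ 2 - 1 / K ^ 2 * ∑' N : ℤ, (N : ℝ) * e N ^ 2 +
        1 / K ^ 3 * ∑' N : ℤ, (|(N : ℝ)| ^ 2 + |(N : ℝ)| ^ 3) * e N ^ 2 := by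
        rw [Summable.tsum_add ((s_e.mul_left _).sub (s_Ne.mul_left _)) (s_Qe.mul_left _),
          Summable.tsum_sub (s_e.mul_left _) (s_Ne.mul_left _), tsum_mul_left, tsum_mul_left,
          tsum_mul_left]
    _ ≤ 1 / K * (1 + M / K ^ 2) - 1 / K ^ 2 * (-(2 * (M / K))) + 1 / K ^ 3 * (B * L) := by
        gcongr
    _ = _ := by field_simp; ring

end Bounds

/-! ### Real binomial coefficients -/

theorem succ_mul_choose_succ (a : ℝ) (n : ℕ) :
    ((n : ℝ) + 1) * Ring.choose a (n + 1) = (a - n) * Ring.choose a n := by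
  rw [Ring.choose_eq_smul, Ring.choose_eq_smul, descPochhammer_succ_right,
    Polynomial.smeval_mul, Polynomial.smeval_sub, Polynomial.smeval_X, Polynomial.smeval_natCast,
    Nat.factorial_succ]
  have : (n.factorial : ℝ) ≠ 0 := by positivity
  push_cast
  simp only [smul_eq_mul, pow_one, nsmul_eq_mul, pow_zero, mul_one]
  field_simp

/-- The ratio of consecutive coefficients is `(a - n) / (n + 1)`, of modulus at most one. -/
theorem abs_choose_le_one {a : ℝ} (ha : |a| ≤ 1) (n : ℕ) : |Ring.choose a n| ≤ 1 := by
  induction n with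
  | zero => simp
  | succ n ih =>
    have hn : (0 : ℝ) < (n : ℝ) + 1 := by positivity
    have h := congrArg abs (succ_mul_choose_succ a n)
    rw [abs_mul, abs_mul, abs_of_pos hn] at h
    have h2 : |a - n| ≤ n + 1 := by
      rw [abs_le] at ha ⊢
      constructor <;> [linarith [ha.1]; linarith [ha.2, (Nat.cast_nonneg n : (0 : ℝ) ≤ n)]]
    have h3 : |a - n| * |Ring.choose a n| ≤ (n + 1) * 1 :=
      mul_le_mul h2 ih (abs_nonneg _) hn.le
    rw [← h] at h3
    exact le_of_mul_le_mul_left h3 hn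

/-- This is Vandermonde's identity for `a + (-a) = 0`, that is, `(1 + x)^a (1 + x)^(-a) = 1`. -/
theorem sum_choose_mul_choose_neg (a : ℝ) {n : ℕ} (hn : 1 ≤ n) :
    ∑ j ∈ Finset.range (n + 1), Ring.choose a j * Ring.choose (-a) (n - j) = 0 := by
  have h := Ring.add_choose_eq n (Commute.all a (-a))
  rw [add_neg_cancel, Ring.choose_zero_pos ℝ (by omega),
    Finset.Nat.sum_antidiagonal_eq_sum_range_succ_mk] at h
  exact h.symm

theorem hasSum_choose_mul_pow (a : ℝ) {x : ℂ} (hx : ‖x‖ < 1) :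
    HasSum (fun n : ℕ => ((Ring.choose a n : ℝ) : ℂ) * x ^ n) ((1 + x) ^ (a : ℂ)) := by
  have h := (Complex.one_add_cpow_hasFPowerSeriesOnBall_zero (a := (a : ℂ))).hasSum (y := x) (by
    rw [← ENNReal.ofReal_one, Metric.eball_ofReal]; simpa using hx)
  rw [zero_add] at h
  refine h.congr_fun fun n => ?_
  rw [binomialSeries_apply, Complex.ofReal_choose]
  simp

/-- Coefficients of `(1 + ρ x) ^ (-a)`, extended by zero to negative indices. -/
noncomputable def negBinomCoeff (a ρ : ℝ) (N : ℤ) : ℝ :=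
  if N < 0 then 0 else Ring.choose (-a) N.toNat * ρ ^ N.toNat

theorem negBinomCoeff_natCast (a ρ : ℝ) (n : ℕ) :
    negBinomCoeff a ρ n = Ring.choose (-a) n * ρ ^ n := by
  simp [negBinomCoeff]

theorem negBinomCoeff_of_neg (a ρ : ℝ) {N : ℤ} (hN : N < 0) : negBinomCoeff a ρ N = 0 :=
  if_pos hN

theorem abs_negBinomCoeff_le {a ρ : ℝ} (ha : |a| ≤ 1) (h0 : 0 < ρ) (N : ℤ) :
    |negBinomCoeff a ρ N| ≤ ρ ^ N.natAbs := by
  rcases lt_or_ge N 0 with h | h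
  · rw [negBinomCoeff_of_neg a ρ h, abs_zero]; positivity
  · lift N to ℕ using h
    rw [negBinomCoeff_natCast, abs_mul, Int.natAbs_natCast, abs_of_pos (pow_pos h0 N)]
    exact mul_le_of_le_one_left (by positivity) (abs_choose_le_one (by rwa [abs_neg]) N)

/-- The ℓ² estimate for the mutually inverse series `(1 + ρx)^a` and `(1 + ρx)^(-a)`. -/
theorem exists_tsum_binom_sq_div_le {a ρ : ℝ} (ha : |a| ≤ 1) (h0 : 0 < ρ) (h1 : ρ < 1) :
    ∃ A : ℝ, 0 ≤ A ∧ ∀ k : ℕ,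
      ∑' n : ℕ, (∑ j ∈ Finset.range (k + 1),
        Ring.choose a j * ρ ^ j * negBinomCoeff a ρ ((n : ℤ) - k + j)) ^ 2 / ((n : ℝ) + 1) ≤
        1 / ((k : ℝ) + 1) + A / ((k : ℝ) + 1) ^ 3 := by
  refine exists_tsum_sq_div_le (c := fun j => Ring.choose a j * ρ ^ j) h0 h1 (fun j => ?_)
    (abs_negBinomCoeff_le ha h0) (by simp) ?_ (fun N => negBinomCoeff_of_neg a ρ) fun n hn => ?_
  · rw [abs_mul, abs_of_pos (pow_pos h0 j)]
    exact mul_le_of_le_one_left (by positivity) (abs_choose_le_one ha j)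
  · simpa using negBinomCoeff_natCast a ρ 0
  · rw [← mul_zero (ρ ^ n), ← sum_choose_mul_choose_neg a hn, Finset.mul_sum]
    refine Finset.sum_congr rfl fun j hj => ?_
    rw [Finset.mem_range] at hj
    rw [← Nat.cast_sub (by omega), negBinomCoeff_natCast]
    calc _ = ρ ^ (j + (n - j)) * (Ring.choose a j * Ring.choose (-a) (n - j)) := by
          rw [pow_add]; ring
      _ = _ := by rw [show j + (n - j) = n by omega]

/-! ### Power series in the Bergman space of the unit disc -/

theorem integral_exp_int_mul_I (n : ℤ) :
    ∫ θ in Set.Ioo (-Real.pi) Real.pi, Complex.exp (n * θ * Complex.I) =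
      if n = 0 then 2 * (Real.pi : ℂ) else 0 := by
  have hpi : -Real.pi ≤ Real.pi := by linarith [Real.pi_pos]
  rw [← integral_Ioc_eq_integral_Ioo, ← intervalIntegral.integral_of_le hpi]
  split_ifs with h
  · subst h; simp; ring
  · have hc : (n : ℂ) * Complex.I ≠ 0 := by simp [h]
    have := integral_exp_mul_complex (a := -Real.pi) (b := Real.pi) hc
    simp_rw [show ∀ θ : ℝ, (n : ℂ) * θ * Complex.I = n * Complex.I * θ from fun θ => by ring]
    rw [this]
    have e : Complex.exp (n * Complex.I * Real.pi) = Complex.exp (n * Complex.I * (-Real.pi : ℝ)) := by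
      rw [Complex.exp_eq_exp_iff_exists_int]
      exact ⟨n, by push_cast; ring⟩
    rw [e, sub_self, zero_div]

theorem setIntegral_ball_pow_mul_conj_pow (i j : ℕ) :
    ∫ u in ball (0 : ℂ) 1, u ^ i * (starRingEnd ℂ) (u ^ j) =
      if i = j then (Real.pi : ℂ) / (i + 1) else 0 := by
  rw [← integral_indicator measurableSet_ball, ← Complex.integral_comp_polarCoord_symm,
    polarCoord_target]
  have e : ∀ p ∈ Set.Ioi (0 : ℝ) ×ˢ Set.Ioo (-Real.pi) Real.pi,
      p.1 • (ball (0 : ℂ) 1).indicator (fun u => u ^ i * (starRingEnd ℂ) (u ^ j))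
        (Complex.polarCoord.symm p) =
      (Set.Ioo (0 : ℝ) 1).indicator (fun x => (x : ℂ) ^ (i + j + 1)) p.1 *
        Complex.exp (((i : ℤ) - j : ℤ) * p.2 * Complex.I) := by
    rintro ⟨x, θ⟩ ⟨hx, -⟩
    have hx : 0 < x := hx
    have hs : Complex.polarCoord.symm (x, θ) = x * Complex.exp (θ * Complex.I) := by
      rw [Complex.polarCoord_symm_apply, Complex.exp_mul_I]; simp
    rw [hs]
    have hn : ‖(x : ℂ) * Complex.exp (θ * Complex.I)‖ = x := by
      rw [norm_mul, Complex.norm_exp_ofReal_mul_I, mul_one, Complex.norm_real,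
        Real.norm_of_nonneg hx.le]
    by_cases h : x < 1
    · rw [Set.indicator_of_mem (by rwa [mem_ball_zero_iff, hn]),
        Set.indicator_of_mem (Set.mem_Ioo.mpr ⟨hx, h⟩)]
      rw [map_pow, map_mul, Complex.conj_ofReal, ← Complex.exp_conj, map_mul, Complex.conj_I,
        Complex.conj_ofReal, Complex.real_smul, mul_pow, mul_pow, ← Complex.exp_nat_mul,
        ← Complex.exp_nat_mul]
      rw [show (((i : ℤ) - j : ℤ) : ℂ) * θ * Complex.I =
        i * (θ * Complex.I) + j * (θ * -Complex.I) by push_cast; ring, Complex.exp_add]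
      ring
    · rw [Set.indicator_of_notMem (by rwa [mem_ball_zero_iff, hn]),
        Set.indicator_of_notMem (fun h' => h h'.2)]
      simp
  rw [setIntegral_congr_fun (measurableSet_Ioi.prod measurableSet_Ioo) e, Measure.volume_eq_prod,
    setIntegral_prod_mul (fun x : ℝ => (Set.Ioo (0 : ℝ) 1).indicator (fun x => (x : ℂ) ^ (i + j + 1)) x)
      (fun θ : ℝ => Complex.exp (((i : ℤ) - j : ℤ) * θ * Complex.I)),
    integral_exp_int_mul_I]
  rw [setIntegral_indicator measurableSet_Ioo]
  have hI : Set.Ioi (0 : ℝ) ∩ Set.Ioo 0 1 = Set.Ioo 0 1 := by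
    ext x; simp
  rw [hI, ← integral_Ioc_eq_integral_Ioo, ← intervalIntegral.integral_of_le zero_le_one]
  by_cases h : i = j
  · subst h
    have : (i : ℂ) + 1 ≠ 0 := by exact_mod_cast i.succ_ne_zero
    have h2 : ∫ x in (0 : ℝ)..1, (x : ℂ) ^ (i + i + 1) = 1 / ((i + i + 1) + 1) := by
      have := integral_pow (a := 0) (b := 1) (i + i + 1)
      have e : ∀ x : ℝ, (x : ℂ) ^ (i + i + 1) = ((x ^ (i + i + 1) : ℝ) : ℂ) := by simp
      simp_rw [e]
      rw [intervalIntegral.integral_ofReal, this]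
      push_cast
      rw [one_pow, zero_pow (by omega), sub_zero]
    rw [h2, sub_self, if_pos rfl, if_pos rfl,
      show (i : ℂ) + i + 1 + 1 = 2 * (i + 1) by ring]
    field_simp
  · rw [if_neg (by omega), if_neg h, mul_zero]

section PowerSeries

variable {E : ℕ → ℂ} {f : ℂ → ℂ}

theorem continuousOn_of_hasSum_pow (hE : Summable fun n => ‖E n‖)
    (hf : ∀ u ∈ ball (0 : ℂ) 1, HasSum (fun n => E n * u ^ n) (f u)) :
    ContinuousOn f (ball (0 : ℂ) 1) := by
  have h : ContinuousOn (fun u => ∑' n, E n * u ^ n) (ball (0 : ℂ) 1) := by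
    refine continuousOn_tsum (fun n => by fun_prop) hE fun n u hu => ?_
    rw [norm_mul, norm_pow]
    exact mul_le_of_le_one_right (norm_nonneg _) (pow_le_one₀ (norm_nonneg _) (by simpa using (mem_ball.mp hu).le))
  exact h.congr fun u hu => (hf u hu).tsum_eq.symm

/-- Integration against `conj f` may be done coefficientwise. -/
theorem hasSum_integral_mul_conj (hE : Summable fun n => ‖E n‖)
    (hf : ∀ u ∈ ball (0 : ℂ) 1, HasSum (fun n => E n * u ^ n) (f u)) {g : ℂ → ℂ} {B : ℝ}
    (hg : ContinuousOn g (ball (0 : ℂ) 1)) (hB : ∀ u ∈ ball (0 : ℂ) 1, ‖g u‖ ≤ B) :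
    HasSum (fun n => (starRingEnd ℂ) (E n) *
        ∫ u in ball (0 : ℂ) 1, g u * (starRingEnd ℂ) (u ^ n))
      (∫ u in ball (0 : ℂ) 1, g u * (starRingEnd ℂ) (f u)) := by
  have hfin : IsFiniteMeasure (volume.restrict (ball (0 : ℂ) 1)) :=
    isFiniteMeasure_restrict.mpr measure_ball_lt_top.ne
  have hm : ∀ n, AEStronglyMeasurable
      (fun u => (starRingEnd ℂ) (E n) * (g u * (starRingEnd ℂ) (u ^ n)))
      (volume.restrict (ball (0 : ℂ) 1)) := fun n => by
    refine ContinuousOn.aestronglyMeasurable ?_ measurableSet_ball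
    exact continuousOn_const.mul (hg.mul (by fun_prop))
  have h := hasSum_integral_of_dominated_convergence
    (F := fun n u => (starRingEnd ℂ) (E n) * (g u * (starRingEnd ℂ) (u ^ n)))
    (f := fun u => g u * (starRingEnd ℂ) (f u)) (μ := volume.restrict (ball (0 : ℂ) 1))
    (fun n _ => ‖E n‖ * B) hm ?_ ?_ ?_ ?_
  · simpa only [integral_const_mul] using h
  · intro n
    refine (ae_restrict_iff' measurableSet_ball).mpr (ae_of_all _ fun u hu => ?_)
    rw [norm_mul, norm_mul, RCLike.norm_conj, RCLike.norm_conj, norm_pow]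
    have h1 : ‖u‖ ^ n ≤ 1 := pow_le_one₀ (norm_nonneg _) (by simpa using (mem_ball.mp hu).le)
    gcongr
    calc ‖g u‖ * ‖u‖ ^ n ≤ B * 1 := by
          gcongr
          · exact (norm_nonneg _).trans (hB u hu)
          · exact hB u hu
      _ = B := mul_one B
  · exact ae_of_all _ fun u => hE.mul_right B
  · exact integrable_const _
  · refine (ae_restrict_iff' measurableSet_ball).mpr (ae_of_all _ fun u hu => ?_)
    have := (Complex.hasSum_conj'.mpr (hf u hu)).mul_left (g u)
    refine this.congr_fun fun n => ?_
    rw [map_mul]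
    ring

theorem integral_pow_mul_conj (hE : Summable fun n => ‖E n‖)
    (hf : ∀ u ∈ ball (0 : ℂ) 1, HasSum (fun n => E n * u ^ n) (f u)) (i : ℕ) :
    ∫ u in ball (0 : ℂ) 1, u ^ i * (starRingEnd ℂ) (f u) =
      Real.pi / (i + 1) * (starRingEnd ℂ) (E i) := by
  have h := hasSum_integral_mul_conj hE hf (g := fun u => u ^ i) (B := 1) (by fun_prop)
    fun u hu => by
      rw [norm_pow]; exact pow_le_one₀ (norm_nonneg _) (by simpa using (mem_ball.mp hu).le)
  simp_rw [setIntegral_ball_pow_mul_conj_pow] at h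
  have h2 := hasSum_single (f := fun n => (starRingEnd ℂ) (E n) *
    if i = n then (Real.pi : ℂ) / (i + 1) else 0) i fun n hn => by rw [if_neg hn.symm, mul_zero]
  rw [h.unique h2, if_pos rfl, mul_comm]

theorem norm_le_tsum_of_hasSum_pow (hE : Summable fun n => ‖E n‖)
    (hf : ∀ u ∈ ball (0 : ℂ) 1, HasSum (fun n => E n * u ^ n) (f u)) {u : ℂ}
    (hu : u ∈ ball (0 : ℂ) 1) : ‖f u‖ ≤ ∑' n, ‖E n‖ := by
  rw [← (hf u hu).tsum_eq]
  refine tsum_of_norm_bounded hE.hasSum fun n => ?_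
  rw [norm_mul, norm_pow]
  exact mul_le_of_le_one_right (norm_nonneg _)
    (pow_le_one₀ (norm_nonneg _) (by simpa using (mem_ball.mp hu).le))

/-- Parseval's identity in the Bergman space of the unit disc. -/
theorem integral_norm_sq_eq_tsum (hE : Summable fun n => ‖E n‖)
    (hf : ∀ u ∈ ball (0 : ℂ) 1, HasSum (fun n => E n * u ^ n) (f u)) :
    ∫ u in ball (0 : ℂ) 1, ‖f u‖ ^ 2 = Real.pi * ∑' n : ℕ, ‖E n‖ ^ 2 / ((n : ℝ) + 1) := by
  have h := hasSum_integral_mul_conj hE hf (continuousOn_of_hasSum_pow hE hf)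
    fun u hu => norm_le_tsum_of_hasSum_pow hE hf hu
  have e : ∀ n, ∫ u in ball (0 : ℂ) 1, f u * (starRingEnd ℂ) (u ^ n) =
      Real.pi / (n + 1) * E n := by
    intro n
    have := congrArg (starRingEnd ℂ) (integral_pow_mul_conj hE hf n)
    rw [← integral_conj] at this
    simpa [mul_comm] using this
  simp_rw [e] at h
  have e2 : ∀ u, f u * (starRingEnd ℂ) (f u) = ((‖f u‖ ^ 2 : ℝ) : ℂ) := fun u => by
    rw [Complex.mul_conj']; simp
  simp_rw [e2] at h
  rw [integral_complex_ofReal] at h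
  have e3 : ∀ n : ℕ, (starRingEnd ℂ) (E n) * (Real.pi / (n + 1) * E n) =
      ((Real.pi * (‖E n‖ ^ 2 / ((n : ℝ) + 1)) : ℝ) : ℂ) := fun n => by
    rw [mul_left_comm, Complex.conj_mul']; push_cast; ring
  simp_rw [e3] at h
  rw [← tsum_mul_left]
  exact (Complex.hasSum_ofReal.mp h).tsum_eq.symm

end PowerSeries

/-! ### Parametrising the lemniscate region by the unit disc -/

theorem setIntegral_image_eq_norm_deriv_sq {g g' : ℂ → ℂ} {s : Set ℂ} (hs : MeasurableSet s)
    (hg : ∀ u ∈ s, HasDerivAt g (g' u) u) (hinj : Set.InjOn g s) (F : ℂ → ℝ) :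
    ∫ z in g '' s, F z = ∫ u in s, ‖g' u‖ ^ 2 * F (g u) := by
  rw [integral_image_eq_integral_abs_det_fderiv_smul volume hs
    (fun u hu => (hg u hu).complexToReal_fderiv.hasFDerivWithinAt) hinj]
  refine setIntegral_congr_fun hs fun u _ => ?_
  -- The real determinant of multiplication by a complex number is its norm in the algebra ℂ over ℝ.
  have : (g' u • (1 : ℂ →L[ℝ] ℂ)).det = ‖g' u‖ ^ 2 := by
    rw [← Complex.normSq_eq_norm_sq, ← Algebra.norm_complex_apply, Algebra.norm_apply]
    rfl
  simp only [smul_eq_mul]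
  rw [this, abs_of_nonneg (sq_nonneg _)]

/-- The principal branch of the `m`-th root of `1 + ρ u`. -/
noncomputable def rootBranch (ρ : ℝ) (m : ℕ) (u : ℂ) : ℂ := (1 + ρ * u) ^ (((1 / m : ℝ)) : ℂ)

section

variable {ρ : ℝ} {m : ℕ} {u : ℂ}

theorem one_add_mem_slitPlane (h0 : 0 < ρ) (h1 : ρ < 1) (hu : u ∈ closedBall (0 : ℂ) 1) :
    1 + (ρ : ℂ) * u ∈ Complex.slitPlane := by
  refine Complex.mem_slitPlane_of_norm_lt_one ?_
  rw [norm_mul, Complex.norm_real, Real.norm_of_nonneg h0.le]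
  have : ‖u‖ ≤ 1 := by simpa using hu
  nlinarith [norm_nonneg u]

theorem one_add_ne_zero (h0 : 0 < ρ) (h1 : ρ < 1) (hu : u ∈ closedBall (0 : ℂ) 1) :
    1 + (ρ : ℂ) * u ≠ 0 :=
  Complex.slitPlane_ne_zero (one_add_mem_slitPlane h0 h1 hu)

theorem rootBranch_pow (hm : m ≠ 0) : rootBranch ρ m u ^ m = 1 + ρ * u := by
  rw [rootBranch, one_div, Complex.ofReal_inv, Complex.ofReal_natCast,
    Complex.cpow_nat_inv_pow _ hm]

theorem norm_rootBranch : ‖rootBranch ρ m u‖ = ‖1 + (ρ : ℂ) * u‖ ^ (1 / m : ℝ) :=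
  Complex.norm_cpow_real _ _

theorem rootBranch_ne_zero (h0 : 0 < ρ) (h1 : ρ < 1) (hm : m ≠ 0) (hu : u ∈ closedBall (0 : ℂ) 1) :
    rootBranch ρ m u ≠ 0 := by
  intro h
  apply one_add_ne_zero h0 h1 hu
  rw [← rootBranch_pow (m := m) hm, h, zero_pow hm]

theorem hasDerivAt_rootBranch (h0 : 0 < ρ) (h1 : ρ < 1) (hu : u ∈ closedBall (0 : ℂ) 1) :
    HasDerivAt (rootBranch ρ m)
      ((1 / m : ℝ) * (1 + ρ * u) ^ ((1 / m - 1 : ℝ) : ℂ) * ρ) u := by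
  have h := (((hasDerivAt_id u).const_mul (ρ : ℂ)).const_add 1).cpow_const (c := ((1 / m : ℝ) : ℂ))
    (one_add_mem_slitPlane h0 h1 hu)
  have e : rootBranch ρ m = fun u : ℂ => (1 + (ρ : ℂ) * u) ^ (((1 / m : ℝ)) : ℂ) := rfl
  simpa [e] using! h

theorem integrableOn_pullback (h0 : 0 < ρ) (h1 : ρ < 1) (b c : ℝ) (w : ℂ) {F : ℂ → ℝ}
    (hF : Continuous F) : IntegrableOn (fun u => (c * ‖1 + (ρ : ℂ) * u‖ ^ b) ^ 2 *
      F (w * rootBranch ρ m u)) (ball 0 1) := by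
  refine (ContinuousOn.integrableOn_compact (isCompact_closedBall 0 1) ?_).mono_set
    ball_subset_closedBall
  have c1 : ContinuousOn (rootBranch ρ m) (closedBall 0 1) := fun u hu =>
    (hasDerivAt_rootBranch h0 h1 hu).continuousAt.continuousWithinAt
  have c2 : ContinuousOn (fun u : ℂ => ‖1 + (ρ : ℂ) * u‖ ^ b) (closedBall 0 1) :=
    ContinuousOn.rpow_const (by fun_prop)
      fun u hu => Or.inl (norm_ne_zero_iff.mpr (one_add_ne_zero h0 h1 hu))
  exact ((continuousOn_const.mul c2).pow 2).mul
    (hF.comp_continuousOn (continuousOn_const.mul c1))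

end

/-- As `r^m < 1`, the disc `|w - 1| < r^m` avoids `0`, so its preimage under `z ↦ z^m` splits into
`m` petals. A point `z` determines `u = (z^m - 1) / r^m`, hence `z / rootBranch` is an `m`-th root
of unity and fixes the petal. -/
theorem integral_lemniscateArea {r : ℝ} (hr0 : 0 < r) (hr1 : r < 1) {m : ℕ} (hm : m ≠ 0) {ζ : ℂ}
    (hζ : IsPrimitiveRoot ζ m) {F : ℂ → ℝ} (hF : Continuous F) :
    ∫ z, F z ∂lemniscateArea r m = ∑ j ∈ Finset.range m, ∫ u in ball (0 : ℂ) 1,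
      (r ^ m / m * ‖1 + ((r ^ m : ℝ) : ℂ) * u‖ ^ (1 / m - 1 : ℝ)) ^ 2 *
        F (ζ ^ j * rootBranch (r ^ m) m u) := by
  set ρ := r ^ m with hρ
  have h0 : 0 < ρ := pow_pos hr0 m
  have h1 : ρ < 1 := pow_lt_one₀ hr0.le hr1 hm
  set g : ℕ → ℂ → ℂ := fun j u => ζ ^ j * rootBranch ρ m u with hg
  have hζ0 : ζ ≠ 0 := hζ.ne_zero hm
  have hζ1 : ‖ζ‖ = 1 := hζ.norm'_eq_one hm
  have gpow : ∀ j u, g j u ^ m = 1 + ρ * u := fun j u => by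
    rw [hg]; simp only
    rw [mul_pow, rootBranch_pow hm, ← pow_mul, mul_comm j, pow_mul, hζ.pow_eq_one, one_pow, one_mul]
  have inj : ∀ {i j u v}, g i u = g j v → u = v := fun {i j u v} h => by
    have := congrArg (· ^ m) h
    simp only [gpow, add_right_inj] at this
    exact mul_left_cancel₀ (by exact_mod_cast h0.ne') this
  have hderiv : ∀ j, ∀ u ∈ ball (0 : ℂ) 1, HasDerivAt (g j)
      (ζ ^ j * ((1 / m : ℝ) * (1 + ρ * u) ^ ((1 / m - 1 : ℝ) : ℂ) * ρ)) u := fun j u hu =>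
    (hasDerivAt_rootBranch h0 h1 (ball_subset_closedBall hu)).const_mul _
  have hregion : lemniscateRegion r m = ⋃ j ∈ Finset.range m, g j '' ball (0 : ℂ) 1 := by
    ext z
    simp only [lemniscateRegion, Set.mem_ofPred_eq, Set.mem_iUnion, Set.mem_image, exists_prop,
      Finset.mem_range]
    constructor
    · intro hz
      set u : ℂ := (z ^ m - 1) / ρ with hu
      have hu1 : u ∈ ball (0 : ℂ) 1 := by
        rw [mem_ball_zero_iff, hu, norm_div, Complex.norm_real, Real.norm_of_nonneg h0.le,
          div_lt_one h0]
        exact hz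
      have hzu : z ^ m = 1 + ρ * u := by
        rw [hu, mul_div_cancel₀ _ (by exact_mod_cast h0.ne')]; ring
      have hx := rootBranch_ne_zero h0 h1 hm (ball_subset_closedBall hu1)
      have : NeZero m := ⟨hm⟩
      obtain ⟨j, hj, hj'⟩ := hζ.eq_pow_of_pow_eq_one (ξ := z / rootBranch ρ m u) (by
        rw [div_pow, rootBranch_pow hm, hzu, div_self (one_add_ne_zero h0 h1 (ball_subset_closedBall hu1))])
      refine ⟨j, hj, u, hu1, ?_⟩
      rw [hg]; simp only
      rw [hj', div_mul_cancel₀ _ hx]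
    · rintro ⟨j, -, u, hu, rfl⟩
      rw [gpow, add_sub_cancel_left, norm_mul, Complex.norm_real, Real.norm_of_nonneg h0.le]
      exact mul_lt_of_lt_one_right h0 (by simpa using hu)
  have hdisj : (↑(Finset.range m) : Set ℕ).Pairwise
      (Function.onFun Disjoint fun j => g j '' ball (0 : ℂ) 1) := by
    intro i hi j hj hij
    rw [Function.onFun, Set.disjoint_left]
    rintro z ⟨u, hu, rfl⟩ ⟨v, hv, h⟩
    obtain rfl := inj h
    have := mul_right_cancel₀ (rootBranch_ne_zero h0 h1 hm (ball_subset_closedBall hu)) h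
    exact hij (hζ.pow_inj (by simpa using hi) (by simpa using hj) this.symm)
  have hmeas : ∀ j ∈ Finset.range m, MeasurableSet (g j '' ball (0 : ℂ) 1) := fun j _ =>
    measurable_image_of_fderivWithin measurableSet_ball
      (fun u hu => (hderiv j u hu).complexToReal_fderiv.hasFDerivWithinAt) (fun u _ v _ h => inj h)
  have hint : ∀ j ∈ Finset.range m, IntegrableOn F (g j '' ball (0 : ℂ) 1) := by
    intro j _
    refine (hF.continuousOn.integrableOn_compact (isCompact_closedBall 0 2)).mono_set ?_
    rintro z ⟨u, hu, rfl⟩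
    rw [mem_closedBall_zero_iff]
    refine le_of_pow_le_pow_left₀ hm zero_le_two ?_
    rw [← norm_pow, gpow]
    have hu' : ‖u‖ ≤ 1 := by simpa using (mem_ball.mp hu).le
    calc ‖1 + (ρ : ℂ) * u‖ ≤ 1 + ρ * ‖u‖ := by
          refine (norm_add_le _ _).trans ?_
          rw [norm_one, norm_mul, Complex.norm_real, Real.norm_of_nonneg h0.le]
      _ ≤ 2 := by nlinarith [norm_nonneg u]
      _ ≤ 2 ^ m := le_self_pow₀ one_le_two hm
  rw [lemniscateArea, hregion, integral_biUnion_finset _ hmeas hdisj hint]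
  refine Finset.sum_congr rfl fun j _ => ?_
  rw [setIntegral_image_eq_norm_deriv_sq measurableSet_ball (hderiv j) (fun u _ v _ h => inj h)]
  refine setIntegral_congr_fun measurableSet_ball fun u _ => ?_
  rw [norm_mul, norm_mul, norm_mul, norm_pow, hζ1, one_pow, one_mul, Complex.norm_cpow_real,
    Complex.norm_real, Complex.norm_real, Real.norm_of_nonneg h0.le,
    Real.norm_of_nonneg (by positivity : (0 : ℝ) ≤ 1 / m)]
  congr 2
  ring

/-! ### Orthogonality and the extremal property -/

theorem monicOrthPoly_eq (μ : Measure ℂ) (n : ℕ) :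
    monicOrthPoly μ n = X ^ n - ∑ j ∈ Finset.range n,
      C (polyInner μ (X ^ n) (monicOrthPoly μ j) /
        polyInner μ (monicOrthPoly μ j) (monicOrthPoly μ j)) * monicOrthPoly μ j := by
  rw [monicOrthPoly, Finset.sum_range]

theorem monicOrthPoly_monic_degree (μ : Measure ℂ) (n : ℕ) :
    (monicOrthPoly μ n).Monic ∧ (monicOrthPoly μ n).degree = n := by
  induction n using Nat.strong_induction_on with
  | _ n ih =>
    have hdeg : (∑ j ∈ Finset.range n,
        C (polyInner μ (X ^ n) (monicOrthPoly μ j) /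
          polyInner μ (monicOrthPoly μ j) (monicOrthPoly μ j)) * monicOrthPoly μ j).degree < n := by
      refine mem_degreeLT.mp (Submodule.sum_mem _ fun j hj => ?_)
      rw [Finset.mem_range] at hj
      rw [← smul_eq_C_mul]
      refine Submodule.smul_mem _ _ (mem_degreeLT.mpr ?_)
      rw [(ih j hj).2]
      exact_mod_cast hj
    rw [monicOrthPoly_eq]
    exact ⟨monic_X_pow_sub hdeg, by
      rw [degree_sub_eq_left_of_degree_lt (by rwa [degree_X_pow]), degree_X_pow]⟩

section InnerProduct

variable {μ : Measure ℂ}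

theorem polyInner_add_left
    (hint : ∀ P Q : ℂ[X], Integrable (fun z => P.eval z * (starRingEnd ℂ) (Q.eval z)) μ)
    (P P' Q : ℂ[X]) : polyInner μ (P + P') Q = polyInner μ P Q + polyInner μ P' Q := by
  rw [polyInner, polyInner, polyInner, ← integral_add (hint _ _) (hint _ _)]
  simp [add_mul]

theorem polyInner_C_mul_left (a : ℂ) (P Q : ℂ[X]) :
    polyInner μ (C a * P) Q = a * polyInner μ P Q := by
  rw [polyInner, polyInner, ← integral_const_mul]
  simp [mul_assoc]

theorem conj_polyInner (P Q : ℂ[X]) : (starRingEnd ℂ) (polyInner μ P Q) = polyInner μ Q P := by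
  rw [polyInner, polyInner, ← integral_conj]
  simp [mul_comm]

theorem polyInner_sub_sum_left
    (hint : ∀ P Q : ℂ[X], Integrable (fun z => P.eval z * (starRingEnd ℂ) (Q.eval z)) μ)
    (P : ℂ[X]) (s : Finset ℕ) (a : ℕ → ℂ) (R : ℕ → ℂ[X]) (Q : ℂ[X]) :
    polyInner μ (P - ∑ j ∈ s, C (a j) * R j) Q =
      polyInner μ P Q - ∑ j ∈ s, a j * polyInner μ (R j) Q := by
  induction s using Finset.induction_on with
  | empty => simp
  | insert i s hi ih =>
    rw [Finset.sum_insert hi, Finset.sum_insert hi,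
      show P - (C (a i) * R i + ∑ j ∈ s, C (a j) * R j) =
        C (-a i) * R i + (P - ∑ j ∈ s, C (a j) * R j) by rw [C_neg]; ring,
      polyInner_add_left hint, ih, polyInner_C_mul_left]
    ring

theorem polyInner_self (P : ℂ[X]) :
    polyInner μ P P = ((∫ z, ‖P.eval z‖ ^ 2 ∂μ : ℝ) : ℂ) := by
  rw [polyInner, ← integral_complex_ofReal]
  simp [Complex.mul_conj']

theorem integrable_norm_eval_sq
    (hint : ∀ P Q : ℂ[X], Integrable (fun z => P.eval z * (starRingEnd ℂ) (Q.eval z)) μ)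
    (P : ℂ[X]) : Integrable (fun z => ‖P.eval z‖ ^ 2) μ := by
  have h := (hint P P).norm
  simpa [sq] using h

/-- Such a `Q` vanishes almost everywhere. This covers the degenerate Gram–Schmidt step, where the
division by zero gives coefficient `0`. -/
theorem polyInner_eq_zero_of_self_eq_zero
    (hint : ∀ P Q : ℂ[X], Integrable (fun z => P.eval z * (starRingEnd ℂ) (Q.eval z)) μ)
    {Q : ℂ[X]} (hQ : polyInner μ Q Q = 0) (P : ℂ[X]) : polyInner μ P Q = 0 := by
  rw [polyInner_self, Complex.ofReal_eq_zero, integral_eq_zero_iff_of_nonneg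
    (fun _ => sq_nonneg _) (integrable_norm_eval_sq hint Q)] at hQ
  refine integral_eq_zero_of_ae ?_
  filter_upwards [hQ] with z hz
  have : Q.eval z = 0 := by simpa using hz
  simp [this]

theorem polyInner_monicOrthPoly_of_lt
    (hint : ∀ P Q : ℂ[X], Integrable (fun z => P.eval z * (starRingEnd ℂ) (Q.eval z)) μ)
    (n : ℕ) : ∀ j < n, polyInner μ (monicOrthPoly μ n) (monicOrthPoly μ j) = 0 := by
  induction n using Nat.strong_induction_on with
  | _ n ih =>
    intro j hj
    have off : ∀ i ∈ Finset.range n, i ≠ j →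
        polyInner μ (X ^ n) (monicOrthPoly μ i) / polyInner μ (monicOrthPoly μ i) (monicOrthPoly μ i) *
          polyInner μ (monicOrthPoly μ i) (monicOrthPoly μ j) = 0 := by
      intro i hi hij
      rw [Finset.mem_range] at hi
      rcases lt_or_gt_of_ne hij with h | h
      · rw [← conj_polyInner (monicOrthPoly μ j), ih j hj i h, map_zero, mul_zero]
      · rw [ih i hi j h, mul_zero]
    rw [monicOrthPoly_eq μ n, polyInner_sub_sum_left hint,
      Finset.sum_eq_single_of_mem j (Finset.mem_range.mpr hj) off]
    by_cases h : polyInner μ (monicOrthPoly μ j) (monicOrthPoly μ j) = 0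
    · rw [h, polyInner_eq_zero_of_self_eq_zero hint h]; simp
    · rw [div_mul_cancel₀ _ h, sub_self]

theorem polyInner_left_monicOrthPoly_eq_zero
    (hint : ∀ P Q : ℂ[X], Integrable (fun z => P.eval z * (starRingEnd ℂ) (Q.eval z)) μ)
    {n : ℕ} {R : ℂ[X]} (hR : R.degree < n) : polyInner μ R (monicOrthPoly μ n) = 0 := by
  -- Induction on a degree bound `N ≤ n` with `n` fixed: the top term of `R` is removed with the
  -- monic orthogonal polynomial of degree `N`.
  suffices h : ∀ N ≤ n, ∀ R : ℂ[X], R.degree < N → polyInner μ R (monicOrthPoly μ n) = 0 from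
    h n le_rfl R hR
  intro N
  induction N with
  | zero =>
    intro _ R hR
    have : R = 0 := by simpa [Nat.WithBot.lt_zero_iff] using hR
    simp [this, polyInner]
  | succ N ih =>
    intro hN R hR
    have hR' : (R - C (R.coeff N) * monicOrthPoly μ N).degree < N := by
      rw [degree_lt_iff_coeff_zero]
      intro i hi
      obtain ⟨hm, hd⟩ := monicOrthPoly_monic_degree μ N
      have hnd : (monicOrthPoly μ N).natDegree = N := natDegree_eq_of_degree_eq_some hd
      rcases hi.eq_or_lt with rfl | h
      · have := hm.coeff_natDegree
        rw [hnd] at this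
        simp [this]
      · rw [coeff_sub, coeff_C_mul, coeff_eq_zero_of_degree_lt (n := i) (p := monicOrthPoly μ N)
          (by rw [hd]; exact_mod_cast h), coeff_eq_zero_of_degree_lt (n := i) (p := R)
          (hR.trans_le (by exact_mod_cast h))]
        simp
    have e : R = (R - C (R.coeff N) * monicOrthPoly μ N) + C (R.coeff N) * monicOrthPoly μ N := by
      ring
    rw [e, polyInner_add_left hint, ih (by omega) _ hR', polyInner_C_mul_left, ← conj_polyInner,
      polyInner_monicOrthPoly_of_lt hint n N (by omega)]
    simp

/-- The monic orthogonal polynomial has minimal `L²` norm among monic polynomials. -/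
theorem integral_norm_monicOrthPoly_sq_le
    (hint : ∀ P Q : ℂ[X], Integrable (fun z => P.eval z * (starRingEnd ℂ) (Q.eval z)) μ)
    {n : ℕ} {P : ℂ[X]} (hP : P.Monic) (hn : P.natDegree = n) :
    ∫ z, ‖(monicOrthPoly μ n).eval z‖ ^ 2 ∂μ ≤ ∫ z, ‖P.eval z‖ ^ 2 ∂μ := by
  set Φ := monicOrthPoly μ n with hΦ
  obtain ⟨hm, hd⟩ := monicOrthPoly_monic_degree μ n
  have hPd : P.degree = n := by rw [degree_eq_natDegree hP.ne_zero, hn]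
  have hR : (P - Φ).degree < n := by
    rw [← hPd]
    exact degree_sub_lt_left (by rw [hPd, hd]) hP.ne_zero (by rw [hP.leadingCoeff, hm.leadingCoeff])
  have h1 : polyInner μ (P - Φ) Φ = 0 := polyInner_left_monicOrthPoly_eq_zero hint hR
  have h2 : polyInner μ P P = polyInner μ (P - Φ) (P - Φ) + polyInner μ Φ Φ := by
    have e1 : polyInner μ P P = polyInner μ (P - Φ) P + polyInner μ Φ P := by
      rw [← polyInner_add_left hint, sub_add_cancel]
    have e2 : ∀ Q, polyInner μ Q P = polyInner μ Q (P - Φ) + polyInner μ Q Φ := fun Q => by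
      rw [← conj_polyInner P, ← conj_polyInner (P - Φ), ← conj_polyInner Φ, ← map_add,
        ← polyInner_add_left hint, sub_add_cancel]
    rw [e1, e2, e2, h1, ← conj_polyInner (P - Φ) Φ, h1]
    simp
  rw [polyInner_self, polyInner_self, polyInner_self] at h2
  have h3 : ∫ z, ‖P.eval z‖ ^ 2 ∂μ =
    ∫ z, ‖(P - Φ).eval z‖ ^ 2 ∂μ + ∫ z, ‖Φ.eval z‖ ^ 2 ∂μ := by exact_mod_cast h2
  have h4 : 0 ≤ ∫ z, ‖(P - Φ).eval z‖ ^ 2 ∂μ := integral_nonneg fun _ => sq_nonneg _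
  linarith

theorem kappa_sq (μ : Measure ℂ) (n : ℕ) :
    kappa μ n ^ 2 = (((∫ z, ‖(monicOrthPoly μ n).eval z‖ ^ 2 ∂μ)⁻¹ : ℝ) : ℂ) := by
  rw [kappa, orthonormalPoly, leadingCoeff_mul, leadingCoeff_C,
    (monicOrthPoly_monic_degree μ n).1.leadingCoeff, mul_one, ← Complex.ofReal_pow, inv_pow,
    Real.sq_sqrt (integral_nonneg fun _ => sq_nonneg _)]

end InnerProduct

theorem integrable_lemniscateArea {r : ℝ} (hr0 : 0 < r) (hr1 : r < 1) {m : ℕ} (hm : m ≠ 0)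
    {f : ℂ → ℂ} (hf : Continuous f) : Integrable f (lemniscateArea r m) := by
  refine (hf.continuousOn.integrableOn_compact (isCompact_closedBall 0 2)).mono_set fun z hz => ?_
  rw [mem_closedBall_zero_iff]
  refine le_of_pow_le_pow_left₀ hm zero_le_two ?_
  have hz : ‖z ^ m - 1‖ < r ^ m := hz
  have h1 : r ^ m < 1 := pow_lt_one₀ hr0.le hr1 hm
  calc ‖z‖ ^ m = ‖(z ^ m - 1) + 1‖ := by rw [sub_add_cancel, norm_pow]
    _ ≤ ‖z ^ m - 1‖ + 1 := by simpa using norm_add_le (z ^ m - 1) 1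
    _ ≤ 2 := by linarith
    _ ≤ 2 ^ m := le_self_pow₀ one_le_two hm

/-! ### The weighted extremal problem on the disc -/

section Disc

variable {a ρ : ℝ} {u : ℂ}

theorem hasSum_negBinomCoeff_shift (a : ℝ) (h0 : 0 < ρ) (h1 : ρ < 1) (i : ℕ)
    (hu : u ∈ ball (0 : ℂ) 1) :
    HasSum (fun n : ℕ => ((negBinomCoeff a ρ ((n : ℤ) - i) : ℝ) : ℂ) * u ^ n)
      (u ^ i * (1 + ρ * u) ^ ((-a : ℝ) : ℂ)) := by
  have hx : ‖(ρ : ℂ) * u‖ < 1 := by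
    rw [norm_mul, Complex.norm_real, Real.norm_of_nonneg h0.le]
    have : ‖u‖ < 1 := by simpa using hu
    nlinarith [norm_nonneg u]
  have h := (hasSum_choose_mul_pow (-a) hx).mul_left (u ^ i)
  rw [← (add_left_injective i).hasSum_iff (fun n hn => ?_)]
  · refine h.congr_fun fun n => ?_
    simp only [Function.comp]
    rw [Nat.cast_add, add_sub_cancel_right, negBinomCoeff_natCast]
    push_cast
    ring
  · rw [negBinomCoeff_of_neg, Complex.ofReal_zero, zero_mul]
    by_contra hlt
    exact hn ⟨n - i, by simp only; omega⟩

theorem summable_norm_negBinomCoeff_shift (ha : |a| ≤ 1) (h0 : 0 < ρ) (h1 : ρ < 1) (i : ℤ) :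
    Summable fun n : ℕ => ‖((negBinomCoeff a ρ ((n : ℤ) - i) : ℝ) : ℂ)‖ := by
  have h := (summable_abs_pow_mul_pow_natAbs h0.le h1 0).comp_injective
    (i := fun n : ℕ => (n : ℤ) - i) fun x y hxy => by simpa using hxy
  refine Summable.of_nonneg_of_le (fun _ => norm_nonneg _) (fun n => ?_) h
  rw [Complex.norm_real]
  simpa using abs_negBinomCoeff_le ha h0 _

theorem integral_norm_pow_sq (k : ℕ) :
    ∫ u in ball (0 : ℂ) 1, ‖u ^ k‖ ^ 2 = Real.pi / (k + 1) := by
  have h := setIntegral_ball_pow_mul_conj_pow k k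
  simp_rw [Complex.mul_conj', ← Complex.ofReal_pow] at h
  rw [integral_complex_ofReal, if_pos trivial] at h
  exact_mod_cast h

theorem continuousOn_one_add_cpow (a : ℝ) (h0 : 0 < ρ) (h1 : ρ < 1) :
    ContinuousOn (fun u : ℂ => (1 + ρ * u) ^ ((-a : ℝ) : ℂ)) (ball 0 1) :=
  ContinuousOn.cpow_const (by fun_prop) fun _ hu =>
    one_add_mem_slitPlane h0 h1 (ball_subset_closedBall hu)

theorem integrableOn_ball_of_bounded {F : Type*} [NormedAddCommGroup F] {g : ℂ → F}
    (hg : ContinuousOn g (ball 0 1)) {B : ℝ} (hB : ∀ u ∈ ball (0 : ℂ) 1, ‖g u‖ ≤ B) :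
    IntegrableOn g (ball (0 : ℂ) 1) :=
  IntegrableOn.of_bound measure_ball_lt_top (hg.aestronglyMeasurable measurableSet_ball) B
    ((ae_restrict_iff' measurableSet_ball).mpr (ae_of_all _ hB))

theorem exists_norm_eval_le (q : ℂ[X]) : ∃ B, ∀ u ∈ ball (0 : ℂ) 1, ‖q.eval u‖ ≤ B := by
  obtain ⟨B, hB⟩ := (isCompact_closedBall (0 : ℂ) 1).exists_bound_of_continuousOn
    (q.continuous.continuousOn)
  exact ⟨B, fun u hu => hB u (ball_subset_closedBall hu)⟩

theorem exists_norm_one_add_cpow_le (ha : |a| ≤ 1) (h0 : 0 < ρ) (h1 : ρ < 1) :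
    ∃ B, ∀ u ∈ ball (0 : ℂ) 1, ‖(1 + ρ * u) ^ ((-a : ℝ) : ℂ)‖ ≤ B := by
  refine ⟨_, fun u hu => norm_le_tsum_of_hasSum_pow
    (f := fun u => (1 + ρ * u) ^ ((-a : ℝ) : ℂ))
    (summable_norm_negBinomCoeff_shift ha h0 h1 0) (fun u hu => ?_) hu⟩
  simpa using hasSum_negBinomCoeff_shift a h0 h1 0 hu

/-- The conjugated factor has Taylor series `u^k` plus higher powers, so orthogonality of monomials
leaves only the coefficient of index `k`. -/
theorem integral_eval_mul_conj (ha : |a| ≤ 1) (h0 : 0 < ρ) (h1 : ρ < 1) {q : ℂ[X]} {k : ℕ}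
    (hq : q.natDegree ≤ k) :
    ∫ u in ball (0 : ℂ) 1, q.eval u *
        (starRingEnd ℂ) (u ^ k * (1 + ρ * u) ^ ((-a : ℝ) : ℂ)) =
      Real.pi / (k + 1) * q.coeff k := by
  have hs : ∀ u, q.eval u * (starRingEnd ℂ) (u ^ k * (1 + ρ * u) ^ ((-a : ℝ) : ℂ)) =
      ∑ i ∈ Finset.range (k + 1), q.coeff i *
        (u ^ i * (starRingEnd ℂ) (u ^ k * (1 + ρ * u) ^ ((-a : ℝ) : ℂ))) := by
    intro u
    rw [eval_eq_sum_range' (Nat.lt_succ_of_le hq), Finset.sum_mul]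
    exact Finset.sum_congr rfl fun i _ => by ring
  have hb : ∀ i : ℕ, IntegrableOn
      (fun u : ℂ => u ^ i * (starRingEnd ℂ) (u ^ k * (1 + ρ * u) ^ ((-a : ℝ) : ℂ)))
      (ball 0 1) := by
    intro i
    obtain ⟨B, hB⟩ := exists_norm_one_add_cpow_le ha h0 h1
    refine integrableOn_ball_of_bounded (B := B) ?_ fun u hu => ?_
    · have := continuousOn_one_add_cpow a h0 h1
      exact (continuousOn_id.pow i).mul
        (Complex.continuous_conj.comp_continuousOn ((continuousOn_id.pow k).mul this))
    · rw [norm_mul, RCLike.norm_conj, norm_mul, norm_pow, norm_pow, ← mul_assoc, ← pow_add]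
      exact (mul_le_of_le_one_left (norm_nonneg _) (pow_le_one₀ (norm_nonneg _)
        (by simpa using (mem_ball.mp hu).le))).trans (hB u hu)
  simp_rw [hs]
  rw [integral_finsetSum _ fun i _ => (hb i).const_mul _]
  simp_rw [integral_const_mul]
  rw [Finset.sum_range_succ, Finset.sum_eq_zero, zero_add]
  · rw [integral_pow_mul_conj (summable_norm_negBinomCoeff_shift ha h0 h1 k)
      (fun u hu => hasSum_negBinomCoeff_shift a h0 h1 k hu)]
    rw [sub_self, ← Nat.cast_zero, negBinomCoeff_natCast]
    simp
    ring
  · intro i hi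
    rw [Finset.mem_range] at hi
    rw [integral_pow_mul_conj (summable_norm_negBinomCoeff_shift ha h0 h1 k)
      (fun u hu => hasSum_negBinomCoeff_shift a h0 h1 k hu), negBinomCoeff_of_neg _ _ (by omega)]
    simp

/-- Lower bound for the weighted Bergman extremal problem. -/
theorem le_integral_norm_weight_mul_eval_sq (ha : |a| ≤ 1) (h0 : 0 < ρ) (h1 : ρ < 1) {q : ℂ[X]}
    {k : ℕ} (hq : q.natDegree ≤ k) {b : ℝ} (hb : q.coeff k = b) :
    b ^ 2 * (Real.pi / (k + 1)) ≤
      ∫ u in ball (0 : ℂ) 1, ‖(1 + ρ * u) ^ ((-a : ℝ) : ℂ) * q.eval u‖ ^ 2 := by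
  set h : ℂ → ℂ := fun u => (1 + ρ * u) ^ ((-a : ℝ) : ℂ) with hh
  obtain ⟨B, hB⟩ := exists_norm_one_add_cpow_le ha h0 h1
  obtain ⟨B', hB'⟩ := exists_norm_eval_le q
  have hc : ContinuousOn h (ball 0 1) := continuousOn_one_add_cpow a h0 h1
  have hu1 : ∀ u ∈ ball (0 : ℂ) 1, ‖u ^ k‖ ≤ 1 := fun u hu => by
    rw [norm_pow]; exact pow_le_one₀ (norm_nonneg _) (by simpa using (mem_ball.mp hu).le)
  have hB0 : 0 ≤ B := (norm_nonneg _).trans (hB 0 (by simp))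
  have hB'0 : 0 ≤ B' := (norm_nonneg _).trans (hB' 0 (by simp))
  have i1 : IntegrableOn (fun u => ‖h u * q.eval u‖ ^ 2) (ball 0 1) := by
    refine integrableOn_ball_of_bounded (B := (B * B') ^ 2)
      ((hc.mul q.continuous.continuousOn).norm.pow 2) fun u hu => ?_
    rw [Real.norm_of_nonneg (sq_nonneg _), norm_mul]
    gcongr
    exacts [hB u hu, hB' u hu]
  have i2 : IntegrableOn (fun u => q.eval u * (starRingEnd ℂ) (u ^ k * h u)) (ball 0 1) := by
    refine integrableOn_ball_of_bounded (B := B' * (1 * B)) (q.continuous.continuousOn.mul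
      (Complex.continuous_conj.comp_continuousOn ((continuousOn_id.pow k).mul hc))) fun u hu => ?_
    rw [norm_mul, RCLike.norm_conj, norm_mul]
    gcongr
    exacts [hB' u hu, hu1 u hu, hB u hu]
  have i3 : IntegrableOn (fun u : ℂ => ‖u ^ k‖ ^ 2) (ball 0 1) := by
    refine integrableOn_ball_of_bounded (B := 1) (by fun_prop) fun u hu => ?_
    rw [Real.norm_of_nonneg (sq_nonneg _)]
    exact pow_le_one₀ (norm_nonneg _) (hu1 u hu)
  have i2' : IntegrableOn (fun u => (q.eval u * (starRingEnd ℂ) (u ^ k * h u)).re) (ball 0 1) :=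
    i2.re
  -- This is `|w - b y|² ≥ 0` with `w = conj(h u) q(u)` and `y = u^k`. Conjugating `h` does not
  -- change `|h q|`.
  have key : ∀ u, 2 * b * (q.eval u * (starRingEnd ℂ) (u ^ k * h u)).re - b ^ 2 * ‖u ^ k‖ ^ 2 ≤
      ‖h u * q.eval u‖ ^ 2 := by
    intro u
    have e : ‖h u * q.eval u‖ = ‖(starRingEnd ℂ) (h u) * q.eval u‖ := by
      rw [norm_mul, norm_mul, RCLike.norm_conj]
    have e2 : q.eval u * (starRingEnd ℂ) (u ^ k * h u) =
        ((starRingEnd ℂ) (h u) * q.eval u) * (starRingEnd ℂ) (u ^ k) := by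
      rw [map_mul]; ring
    rw [e, e2]
    generalize (starRingEnd ℂ) (h u) * q.eval u = w
    generalize u ^ k = y
    rw [← Complex.normSq_eq_norm_sq, ← Complex.normSq_eq_norm_sq, Complex.normSq_apply,
      Complex.normSq_apply, Complex.mul_re, Complex.conj_re, Complex.conj_im]
    nlinarith [sq_nonneg (w.re - b * y.re), sq_nonneg (w.im - b * y.im)]
  have hre : ∫ u in ball (0 : ℂ) 1, (q.eval u * (starRingEnd ℂ) (u ^ k * h u)).re =
      Real.pi / (k + 1) * b := by
    have := integral_re i2
    have h2 := integral_eval_mul_conj ha h0 h1 hq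
    rw [hb] at h2
    refine this.trans ?_
    rw [h2]
    have e : (Real.pi : ℂ) / (k + 1) * b = ((Real.pi / (k + 1) * b : ℝ) : ℂ) := by push_cast; rfl
    rw [e]
    exact Complex.ofReal_re _
  calc b ^ 2 * (Real.pi / (k + 1))
      = 2 * b * (Real.pi / (k + 1) * b) - b ^ 2 * (Real.pi / (k + 1)) := by ring
    _ = ∫ u in ball (0 : ℂ) 1, (2 * b * (q.eval u * (starRingEnd ℂ) (u ^ k * h u)).re -
          b ^ 2 * ‖u ^ k‖ ^ 2) := by
        rw [integral_sub (i2'.const_mul _) (i3.const_mul _), integral_const_mul,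
          integral_const_mul, integral_norm_pow_sq, hre]
    _ ≤ _ := integral_mono ((i2'.const_mul _).sub (i3.const_mul _)) i1 key

/-- Upper bound for the weighted Bergman extremal problem, from truncating the exterior Szegő
function. -/
theorem exists_integral_norm_weight_mul_sum_sq_le (ha : |a| ≤ 1) (h0 : 0 < ρ) (h1 : ρ < 1) :
    ∃ A : ℝ, 0 ≤ A ∧ ∀ k : ℕ,
      ∫ u in ball (0 : ℂ) 1, ‖(1 + ρ * u) ^ ((-a : ℝ) : ℂ) *
        ∑ j ∈ Finset.range (k + 1), ((Ring.choose a j * ρ ^ j : ℝ) : ℂ) * u ^ (k - j)‖ ^ 2 ≤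
      Real.pi * (1 / ((k : ℝ) + 1) + A / ((k : ℝ) + 1) ^ 3) := by
  obtain ⟨A, hA, hk⟩ := exists_tsum_binom_sq_div_le ha h0 h1
  refine ⟨A, hA, fun k => ?_⟩
  -- Taylor coefficients of weight times trial polynomial: the monomial `u^(k-j)` shifts the series
  -- of the weight by `k - j`.
  set E : ℕ → ℂ := fun n => ∑ j ∈ Finset.range (k + 1), ((Ring.choose a j * ρ ^ j : ℝ) : ℂ) *
    ((negBinomCoeff a ρ ((n : ℤ) - (k - j : ℕ)) : ℝ) : ℂ) with hE
  have sE : Summable fun n => ‖E n‖ := by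
    refine Summable.of_nonneg_of_le (fun _ => norm_nonneg _) (fun n => norm_sum_le _ _) ?_
    refine summable_sum fun j _ => ?_
    simp_rw [norm_mul]
    exact (summable_norm_negBinomCoeff_shift ha h0 h1 _).mul_left _
  rw [integral_norm_sq_eq_tsum sE fun u hu => ?_]
  · refine mul_le_mul_of_nonneg_left (le_of_eq_of_le (tsum_congr fun n => ?_) (hk k)) Real.pi_pos.le
    congr 1
    have : E n = ((∑ j ∈ Finset.range (k + 1),
        Ring.choose a j * ρ ^ j * negBinomCoeff a ρ ((n : ℤ) - k + j) : ℝ) : ℂ) := by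
      rw [hE, Complex.ofReal_sum]
      refine Finset.sum_congr rfl fun j hj => ?_
      rw [Finset.mem_range] at hj
      rw [Nat.cast_sub (by omega), sub_sub_eq_add_sub, sub_add_eq_add_sub,
        ← Complex.ofReal_mul]
    rw [this, Complex.norm_real, Real.norm_eq_abs, sq_abs]
  · rw [Finset.mul_sum]
    simp_rw [hE, Finset.sum_mul]
    refine hasSum_sum fun j _ => ?_
    have := (hasSum_negBinomCoeff_shift a h0 h1 (k - j) hu).mul_left
      ((Ring.choose a j * ρ ^ j : ℝ) : ℂ)
    rw [mul_left_comm, mul_comm ((1 + (ρ : ℂ) * u) ^ _)]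
    exact this.congr_fun fun n => by ring

end Disc

/-! ### From the lemniscate region to the disc -/

/-- Averaging over rotations extracts the coefficients of index `≡ s` modulo `m`. -/
theorem sum_rootsOfUnity_eval {m s k : ℕ} (hs : s < m) {ζ : ℂ} (hζ : IsPrimitiveRoot ζ m)
    {P : ℂ[X]} (hP : P.natDegree ≤ k * m + s) (x : ℂ) :
    ∑ j ∈ Finset.range m, ζ ^ (j * (m - s)) * P.eval (ζ ^ j * x) =
      m * (x ^ s * ∑ i ∈ Finset.range (k + 1), P.coeff (i * m + s) * (x ^ m) ^ i) := by
  -- The exponent `m - s + n` stands for `n - s` modulo `m` without negative powers. Hence the index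
  -- `i * m + s` corresponds to the quotient `i + 1`.
  have orth : ∀ n : ℕ, ∑ j ∈ Finset.range m, (ζ ^ (m - s + n)) ^ j =
      if m ∣ m - s + n then (m : ℂ) else 0 := by
    intro n
    split_ifs with h
    · rw [(hζ.pow_eq_one_iff_dvd _).mpr h]; simp
    · have h1 : ζ ^ (m - s + n) ≠ 1 := fun e => h ((hζ.pow_eq_one_iff_dvd _).mp e)
      rw [geom_sum_eq h1, ← pow_mul, mul_comm, pow_mul, hζ.pow_eq_one, one_pow, sub_self, zero_div]
  calc _ = ∑ j ∈ Finset.range m, ∑ n ∈ Finset.range (k * m + s + 1),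
        P.coeff n * x ^ n * (ζ ^ (m - s + n)) ^ j := by
        refine Finset.sum_congr rfl fun j _ => ?_
        rw [eval_eq_sum_range' (Nat.lt_succ_of_le hP), Finset.mul_sum]
        refine Finset.sum_congr rfl fun n _ => ?_
        rw [mul_pow, ← pow_mul, ← pow_mul, add_mul, pow_add, mul_comm (m - s) j, mul_comm n j]
        ring
    _ = ∑ n ∈ Finset.range (k * m + s + 1),
        P.coeff n * x ^ n * if m ∣ m - s + n then (m : ℂ) else 0 := by
        rw [Finset.sum_comm]
        refine Finset.sum_congr rfl fun n _ => ?_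
        rw [← Finset.mul_sum, orth]
    _ = ∑ i ∈ Finset.range (k + 1), m * (x ^ s * (P.coeff (i * m + s) * (x ^ m) ^ i)) := by
        symm
        refine Finset.sum_of_injOn (fun i => i * m + s) ?_ ?_ ?_ ?_
        · intro i _ j _ h
          exact Nat.eq_of_mul_eq_mul_right (by omega) (Nat.add_right_cancel h)
        · intro i hi
          rw [Finset.coe_range, Set.mem_Iio] at hi ⊢
          have : i * m ≤ k * m := Nat.mul_le_mul_right m (by omega)
          simp only
          omega
        · intro n hn hn'
          rw [if_neg, mul_zero]
          rintro ⟨t, ht⟩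
          rw [Finset.mem_range] at hn
          obtain ⟨t, rfl⟩ : ∃ t', t = t' + 1 := ⟨t - 1, by
            rcases Nat.eq_zero_or_pos t with rfl | h
            · omega
            · omega⟩
          rw [Nat.mul_succ, mul_comm] at ht
          have hnt : n = t * m + s := by omega
          refine hn' ⟨t, ?_, hnt.symm⟩
          rw [Finset.coe_range, Set.mem_Iio]
          by_contra h
          have : (k + 1) * m ≤ t * m := Nat.mul_le_mul_right m (by omega)
          rw [Nat.succ_mul] at this
          omega
        · intro i _
          rw [if_pos ⟨i + 1, by rw [Nat.mul_succ, mul_comm m i]; omega⟩]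
          ring
    _ = _ := by rw [Finset.mul_sum, Finset.mul_sum]

/-- With `b = 1 / m` and `t = |1 + ρu|`, the Jacobian factor and `|z|^(2s)` merge into the weight
`t^(-2a)`, where `a = 1 - b - s b`. -/
theorem rpow_weight {t : ℝ} (ht : 0 < t) (c b : ℝ) (s : ℕ) :
    (c * t ^ (b - 1)) ^ 2 * ((t ^ b) ^ s) ^ 2 = c ^ 2 * (t ^ (-(1 - b - s * b))) ^ 2 := by
  rw [← Real.rpow_natCast (t ^ b) s, ← Real.rpow_mul ht.le,
    show -(1 - b - s * b) = (b - 1) + b * s by ring, Real.rpow_add ht]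
  ring

section Extremal

variable {r : ℝ} {m s : ℕ}

theorem abs_exponent_le_one (hs : s < m) : |1 - 1 / (m : ℝ) - s * (1 / m)| ≤ 1 := by
  have hm : (0 : ℝ) < m := by exact_mod_cast (by omega : 0 < m)
  have h1 : (0 : ℝ) ≤ 1 / m := by positivity
  have h2 : (0 : ℝ) ≤ s * (1 / m) := by positivity
  have h3 : 1 / (m : ℝ) + s * (1 / m) ≤ 1 := by
    rw [mul_one_div, ← add_div, div_le_one hm]
    exact_mod_cast (by omega : 1 + s ≤ m)
  rw [abs_le]
  constructor <;> linarith

/-- Cauchy–Schwarz over the `m` branches bounds the sum below by the rotation average, which keeps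
only the coefficients of `P` of index `≡ s` modulo `m`. What remains is the disc problem for `q(u) =
Q(1 + ρu)`, with leading coefficient `ρ^k`. -/
theorem le_integral_norm_eval_sq (hr0 : 0 < r) (hr1 : r < 1) (hs : s < m) {k : ℕ} {P : ℂ[X]}
    (hP : P.Monic) (hdeg : P.natDegree = k * m + s) :
    (r ^ m) ^ (2 * k + 2) / m * (Real.pi / (k + 1)) ≤
      ∫ z, ‖P.eval z‖ ^ 2 ∂lemniscateArea r m := by
  have hm : m ≠ 0 := by omega
  have hmR : (0 : ℝ) < m := by exact_mod_cast (by omega : 0 < m)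
  have hζ := Complex.isPrimitiveRoot_exp m hm
  set ζ := Complex.exp (2 * Real.pi * Complex.I / m)
  rw [integral_lemniscateArea hr0 hr1 hm hζ (by fun_prop)]
  set ρ := r ^ m with hρ
  have h0 : 0 < ρ := pow_pos hr0 m
  have h1 : ρ < 1 := pow_lt_one₀ hr0.le hr1 hm
  set a : ℝ := 1 - 1 / (m : ℝ) - s * (1 / m) with ha
  set Q : ℂ[X] := ∑ i ∈ Finset.range (k + 1), C (P.coeff (i * m + s)) * X ^ i with hQ
  set q : ℂ[X] := Q.comp (C (ρ : ℂ) * X + C 1) with hq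
  have hQdeg : Q.natDegree ≤ k := by
    refine natDegree_sum_le_of_forall_le _ _ fun i hi => ?_
    rw [Finset.mem_range] at hi
    exact (natDegree_C_mul_X_pow_le _ _).trans (by omega)
  have hρC : (ρ : ℂ) ≠ 0 := by exact_mod_cast h0.ne'
  have hlin : (C (ρ : ℂ) * X + C 1).natDegree = 1 := natDegree_linear hρC
  have hQk : Q.coeff k = 1 := by
    rw [hQ, finsetSum_coeff, Finset.sum_eq_single k]
    · rw [coeff_C_mul_X_pow, if_pos rfl, ← hdeg, hP.coeff_natDegree]
    · intro i _ hi
      rw [coeff_C_mul_X_pow, if_neg hi.symm]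
    · simp
  have hQnat : Q.natDegree = k := le_antisymm hQdeg (le_natDegree_of_ne_zero (by simp [hQk]))
  have hqdeg : q.natDegree = k := by rw [hq, natDegree_comp, hQnat, hlin, mul_one]
  have hqk : q.coeff k = ((ρ ^ k : ℝ) : ℂ) := by
    have h : q.leadingCoeff = ((ρ ^ k : ℝ) : ℂ) := by
      rw [hq, leadingCoeff_comp (by rw [hlin]; exact one_ne_zero), leadingCoeff_linear hρC,
        leadingCoeff, hQnat, hQk]
      simp
    rw [← h, leadingCoeff, hqdeg]
  have hlow := le_integral_norm_weight_mul_eval_sq (abs_exponent_le_one hs) h0 h1 hqdeg.le hqk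
  have hpt : ∀ u ∈ ball (0 : ℂ) 1,
      ρ ^ 2 / m * ‖(1 + ρ * u) ^ ((-a : ℝ) : ℂ) * q.eval u‖ ^ 2 ≤
      ∑ j ∈ Finset.range m, (ρ / m * ‖1 + (ρ : ℂ) * u‖ ^ (1 / m - 1 : ℝ)) ^ 2 *
        ‖P.eval (ζ ^ j * rootBranch ρ m u)‖ ^ 2 := by
    intro u hu
    have ht : 0 < ‖1 + (ρ : ℂ) * u‖ := norm_pos_iff.mpr (one_add_ne_zero h0 h1 (ball_subset_closedBall hu))
    have hqe : q.eval u = ∑ i ∈ Finset.range (k + 1),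
        P.coeff (i * m + s) * (rootBranch ρ m u ^ m) ^ i := by
      rw [rootBranch_pow hm, hq, eval_comp, hQ, eval_finsetSum]
      refine Finset.sum_congr rfl fun i _ => ?_
      simp [add_comm]
    have hfil := sum_rootsOfUnity_eval hs hζ hdeg.le (rootBranch ρ m u)
    rw [← hqe] at hfil
    have hcs : ‖(m : ℂ) * (rootBranch ρ m u ^ s * q.eval u)‖ ^ 2 ≤
        m * ∑ j ∈ Finset.range m, ‖P.eval (ζ ^ j * rootBranch ρ m u)‖ ^ 2 := by
      rw [← hfil]
      calc _ ≤ (∑ j ∈ Finset.range m, ‖P.eval (ζ ^ j * rootBranch ρ m u)‖) ^ 2 := by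
            gcongr
            refine (norm_sum_le _ _).trans (Finset.sum_le_sum fun j _ => ?_)
            rw [norm_mul, norm_pow, hζ.norm'_eq_one hm, one_pow, one_mul]
        _ ≤ _ := by
            have := sq_sum_le_card_mul_sum_sq (s := Finset.range m)
              (f := fun j => ‖P.eval (ζ ^ j * rootBranch ρ m u)‖)
            rwa [Finset.card_range] at this
    rw [norm_mul, norm_mul, norm_pow, norm_rootBranch, Complex.norm_natCast] at hcs
    rw [norm_mul, Complex.norm_cpow_real, ← Finset.mul_sum]
    have hw := rpow_weight ht (ρ / m) (1 / m) s
    set t := ‖1 + (ρ : ℂ) * u‖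
    set S := ∑ j ∈ Finset.range m, ‖P.eval (ζ ^ j * rootBranch ρ m u)‖ ^ 2
    have hcs' : m * (((t ^ (1 / m : ℝ)) ^ s) ^ 2 * ‖q.eval u‖ ^ 2) ≤ S := by
      refine le_of_mul_le_mul_left ?_ hmR
      calc _ = (m * ((t ^ (1 / m : ℝ)) ^ s * ‖q.eval u‖)) ^ 2 := by ring
        _ ≤ _ := hcs
    calc ρ ^ 2 / m * (t ^ (-a) * ‖q.eval u‖) ^ 2
        = m * ((ρ / m) ^ 2 * (t ^ (-a)) ^ 2) * ‖q.eval u‖ ^ 2 := by field_simp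
      _ = (ρ / m * t ^ (1 / m - 1 : ℝ)) ^ 2 *
          (m * (((t ^ (1 / m : ℝ)) ^ s) ^ 2 * ‖q.eval u‖ ^ 2)) := by rw [ha, ← hw]; ring
      _ ≤ _ := by gcongr
  have hint : ∀ j ∈ Finset.range m, IntegrableOn
      (fun u => (ρ / m * ‖1 + (ρ : ℂ) * u‖ ^ (1 / m - 1 : ℝ)) ^ 2 *
        ‖P.eval (ζ ^ j * rootBranch ρ m u)‖ ^ 2) (ball 0 1) := fun j _ =>
    integrableOn_pullback h0 h1 _ _ _ (F := fun z => ‖P.eval z‖ ^ 2) (by fun_prop)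
  calc ρ ^ (2 * k + 2) / m * (Real.pi / (k + 1))
      = ρ ^ 2 / m * ((ρ ^ k) ^ 2 * (Real.pi / (k + 1))) := by ring
    _ ≤ ρ ^ 2 / m * ∫ u in ball (0 : ℂ) 1, ‖(1 + ρ * u) ^ ((-a : ℝ) : ℂ) * q.eval u‖ ^ 2 := by
        gcongr
    _ = ∫ u in ball (0 : ℂ) 1, ρ ^ 2 / m * ‖(1 + ρ * u) ^ ((-a : ℝ) : ℂ) * q.eval u‖ ^ 2 := by
        rw [integral_const_mul]
    _ ≤ ∫ u in ball (0 : ℂ) 1, ∑ j ∈ Finset.range m,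
          (ρ / m * ‖1 + (ρ : ℂ) * u‖ ^ (1 / m - 1 : ℝ)) ^ 2 *
            ‖P.eval (ζ ^ j * rootBranch ρ m u)‖ ^ 2 := by
        refine integral_mono_of_nonneg (ae_of_all _ fun u => by positivity)
          (integrable_finsetSum _ hint) ?_
        exact (ae_restrict_iff' measurableSet_ball).mpr (ae_of_all _ hpt)
    _ = _ := integral_finsetSum _ hint

/-- For `P = z^s Q(z^m)` all branches contribute equally, so the Cauchy–Schwarz step of the lower
bound loses nothing. The polynomial `Q` is chosen so that `Q(1 + ρu)` is `ρ^k` times the disc trial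
polynomial. -/
theorem exists_monic_integral_norm_eval_sq_le (hr0 : 0 < r) (hr1 : r < 1) (hs : s < m) :
    ∃ A : ℝ, 0 ≤ A ∧ ∀ k : ℕ, ∃ P : ℂ[X], P.Monic ∧ P.natDegree = k * m + s ∧
      ∫ z, ‖P.eval z‖ ^ 2 ∂lemniscateArea r m ≤
        (r ^ m) ^ (2 * k + 2) / m *
          (Real.pi * (1 / ((k : ℝ) + 1) + A / ((k : ℝ) + 1) ^ 3)) := by
  have hm : m ≠ 0 := by omega
  have hmR : (0 : ℝ) < m := by exact_mod_cast (by omega : 0 < m)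
  have hζ := Complex.isPrimitiveRoot_exp m hm
  set ζ := Complex.exp (2 * Real.pi * Complex.I / m)
  have h0 : 0 < r ^ m := pow_pos hr0 m
  have h1 : r ^ m < 1 := pow_lt_one₀ hr0.le hr1 hm
  obtain ⟨A, hA, hk⟩ := exists_integral_norm_weight_mul_sum_sq_le (abs_exponent_le_one hs) h0 h1
  refine ⟨A, hA, fun k => ?_⟩
  have hk := hk k
  set a : ℝ := 1 - 1 / (m : ℝ) - s * (1 / m) with ha
  -- The second factor `(r ^ m) ^ j` comes from the substitution `X - 1 = ρu`, as `ρ^k u^(k-j) = ρ^j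
  -- (X - 1)^(k-j)`.
  set Q : ℂ[X] := ∑ j ∈ Finset.range (k + 1),
    C ((Ring.choose a j * (r ^ m) ^ j * (r ^ m) ^ j : ℝ) : ℂ) * (X - C 1) ^ (k - j) with hQ
  have hlead : ((X - C (1 : ℂ)) ^ k).Monic := (monic_X_sub_C 1).pow k
  have hlnat : ∀ i, ((X - C (1 : ℂ)) ^ i).natDegree = i := fun i => by
    rw [natDegree_pow, natDegree_X_sub_C, mul_one]
  have hrest : (∑ j ∈ Finset.range k,
      C ((Ring.choose a (j + 1) * (r ^ m) ^ (j + 1) * (r ^ m) ^ (j + 1) : ℝ) : ℂ) *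
        (X - C 1) ^ (k - (j + 1))).degree < ((X - C (1 : ℂ)) ^ k).degree := by
    rw [degree_eq_natDegree hlead.ne_zero, hlnat]
    refine mem_degreeLT.mp (Submodule.sum_mem _ fun j hj => ?_)
    rw [Finset.mem_range] at hj
    rw [← smul_eq_C_mul]
    refine Submodule.smul_mem _ _ (mem_degreeLT.mpr ?_)
    rw [degree_eq_natDegree ((monic_X_sub_C 1).pow _).ne_zero, hlnat]
    exact_mod_cast (by omega : k - (j + 1) < k)
  have hQeq : Q = (∑ j ∈ Finset.range k,
      C ((Ring.choose a (j + 1) * (r ^ m) ^ (j + 1) * (r ^ m) ^ (j + 1) : ℝ) : ℂ) *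
        (X - C 1) ^ (k - (j + 1))) + (X - C (1 : ℂ)) ^ k := by
    rw [hQ, Finset.sum_range_succ']
    simp
  have hQm : Q.Monic := by rw [hQeq]; exact hlead.add_of_right hrest
  have hQn : Q.natDegree = k := by
    rw [hQeq, natDegree_add_eq_right_of_degree_lt hrest, hlnat]
  have hXm : ((X : ℂ[X]) ^ m).Monic := monic_X_pow m
  have hcm : (Q.comp (X ^ m)).Monic := hQm.comp hXm (by rwa [natDegree_X_pow])
  refine ⟨X ^ s * Q.comp (X ^ m), (monic_X_pow s).mul hcm, ?_, ?_⟩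
  · rw [(monic_X_pow s).natDegree_mul hcm, natDegree_X_pow, natDegree_comp, hQn, natDegree_X_pow,
      add_comm]
  rw [integral_lemniscateArea hr0 hr1 hm hζ (by fun_prop)]
  set ρ := r ^ m with hρ
  have hpt : ∀ j, ∀ u ∈ ball (0 : ℂ) 1,
      (ρ / m * ‖1 + (ρ : ℂ) * u‖ ^ (1 / m - 1 : ℝ)) ^ 2 *
        ‖(X ^ s * Q.comp (X ^ m)).eval (ζ ^ j * rootBranch ρ m u)‖ ^ 2 =
      ρ ^ (2 * k + 2) / m ^ 2 * ‖(1 + ρ * u) ^ ((-a : ℝ) : ℂ) *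
        ∑ j ∈ Finset.range (k + 1), ((Ring.choose a j * ρ ^ j : ℝ) : ℂ) * u ^ (k - j)‖ ^ 2 := by
    intro j u hu
    have ht : 0 < ‖1 + (ρ : ℂ) * u‖ :=
      norm_pos_iff.mpr (one_add_ne_zero h0 h1 (ball_subset_closedBall hu))
    have hQe : Q.eval (1 + (ρ : ℂ) * u) = ρ ^ k *
        ∑ j ∈ Finset.range (k + 1), ((Ring.choose a j * ρ ^ j : ℝ) : ℂ) * u ^ (k - j) := by
      rw [hQ, eval_finsetSum, Finset.mul_sum]
      refine Finset.sum_congr rfl fun j hj => ?_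
      rw [Finset.mem_range] at hj
      rw [eval_C_mul, eval_pow, eval_sub, eval_X, eval_C, add_sub_cancel_left, mul_pow]
      conv_rhs => rw [show k = j + (k - j) by omega, pow_add, show j + (k - j) - j = k - j by omega]
      push_cast
      ring
    have hm1 : (ζ ^ j * rootBranch ρ m u) ^ m = 1 + ρ * u := by
      rw [mul_pow, rootBranch_pow hm, ← pow_mul, mul_comm j, pow_mul, hζ.pow_eq_one, one_pow,
        one_mul]
    rw [eval_mul, eval_comp, eval_pow, eval_pow, eval_X, hm1, hQe, norm_mul, norm_pow, norm_mul,
      norm_pow, hζ.norm'_eq_one hm, one_pow, one_mul, norm_rootBranch, norm_mul, norm_mul, norm_pow,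
      Complex.norm_real, Real.norm_of_nonneg h0.le, Complex.norm_cpow_real]
    have hw := rpow_weight ht (ρ / m) (1 / m) s
    rw [← ha] at hw
    generalize ‖∑ j ∈ Finset.range (k + 1), ((Ring.choose a j * ρ ^ j : ℝ) : ℂ) * u ^ (k - j)‖ = S
    calc _ = ((ρ / m * ‖1 + (ρ : ℂ) * u‖ ^ (1 / m - 1 : ℝ)) ^ 2 *
          ((‖1 + (ρ : ℂ) * u‖ ^ (1 / m : ℝ)) ^ s) ^ 2) * (ρ ^ k * S) ^ 2 := by ring
      _ = _ := by rw [hw]; ring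
  rw [Finset.sum_congr rfl fun j _ => setIntegral_congr_fun measurableSet_ball (hpt j),
    Finset.sum_const, Finset.card_range, integral_const_mul, nsmul_eq_mul]
  calc _ = ρ ^ (2 * k + 2) / m * ∫ u in ball (0 : ℂ) 1, ‖(1 + ρ * u) ^ ((-a : ℝ) : ℂ) *
        ∑ j ∈ Finset.range (k + 1), ((Ring.choose a j * ρ ^ j : ℝ) : ℂ) * u ^ (k - j)‖ ^ 2 := by
        rw [← mul_assoc]; congr 1; field_simp
    _ ≤ _ := by gcongr

end Extremal

end OrthPoly

/-! ### Comparing the two bounds with the asserted asymptotics -/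

theorem proposition3p4 (r : ℝ) (hr0 : 0 < r) (hr1 : r < 1) (m s : ℕ) (hs : s + 2 ≤ m)
    (v : ℝ) (hv : v = 2 - 2 / (m : ℝ) - 2 * (s : ℝ) / (m : ℝ)) :
    ∃ ε : ℕ → ℝ, ε =O[atTop] (fun k : ℕ => ((k : ℝ) ^ 2)⁻¹) ∧
      ∀ k : ℕ, 1 ≤ k →
        OrthPoly.kappa (OrthPoly.lemniscateArea r m) (k * m + s) ^ 2 =
          (((((m : ℝ) * k + 1 + s) * (1 + v / (2 * k))) / (Real.pi * r ^ (2 * k * m + 2 * m)) *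
            (1 + ε k) : ℝ) : ℂ) := by
  have hm : m ≠ 0 := by omega
  have hmR : (0 : ℝ) < m := by exact_mod_cast (by omega : 0 < m)
  obtain ⟨A, hA, hup⟩ := OrthPoly.exists_monic_integral_norm_eval_sq_le hr0 hr1
    (by omega : s < m)
  set a : ℝ := 1 - 1 / (m : ℝ) - s / m with ha
  have ha1 : a ≤ 1 := by
    have h1 : (0 : ℝ) ≤ 1 / m := by positivity
    have h2 : (0 : ℝ) ≤ s / m := by positivity
    linarith
  have ha0 : 0 ≤ a := by
    have h3 : 1 / (m : ℝ) + s / m ≤ 1 := by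
      rw [← add_div, div_le_one hmR]
      exact_mod_cast (by omega : 1 + s ≤ m)
    linarith
  have hva : v = 2 * a := by rw [hv, ha]; ring
  set I : ℕ → ℝ := fun k => ∫ z, ‖(OrthPoly.monicOrthPoly (OrthPoly.lemniscateArea r m)
    (k * m + s)).eval z‖ ^ 2 ∂OrthPoly.lemniscateArea r m with hI
  set D : ℕ → ℝ := fun k =>
    (((m : ℝ) * k + 1 + s) * (1 + v / (2 * k))) / (Real.pi * r ^ (2 * k * m + 2 * m)) with hD
  have hlow : ∀ k : ℕ, (r ^ m) ^ (2 * k + 2) / m * (Real.pi / ((k : ℝ) + 1)) ≤ I k := fun k => by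
    obtain ⟨h1, h2⟩ := OrthPoly.monicOrthPoly_monic_degree (OrthPoly.lemniscateArea r m) (k * m + s)
    exact OrthPoly.le_integral_norm_eval_sq hr0 hr1 (by omega) h1 (natDegree_eq_of_degree_eq_some h2)
  have hupp : ∀ k : ℕ, I k ≤ (r ^ m) ^ (2 * k + 2) / m *
      (Real.pi * (1 / ((k : ℝ) + 1) + A / ((k : ℝ) + 1) ^ 3)) := fun k => by
    obtain ⟨P, hP, hdeg, hle⟩ := hup k
    refine (OrthPoly.integral_norm_monicOrthPoly_sq_le (fun P Q => ?_) hP hdeg).trans hle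
    exact OrthPoly.integrable_lemniscateArea hr0 hr1 hm
      (P.continuous.mul (Complex.continuous_conj.comp Q.continuous))
  have hIpos : ∀ k, 0 < I k := fun k => lt_of_lt_of_le (by positivity) (hlow k)
  -- Here `(k + 1 - a)(1 + a/k)` is expanded: the choice of `v` cancels the constant `a`, leaving
  -- `a(1 - a)/k`, which lies in `[0, 1/k]`.
  have hDeq : ∀ k : ℕ, 1 ≤ k → D k = m / ((r ^ m) ^ (2 * k + 2) * Real.pi) *
      ((k : ℝ) + 1 + a * (1 - a) / k) := by
    intro k hk
    have hk0 : (k : ℝ) ≠ 0 := by exact_mod_cast (by omega : k ≠ 0)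
    have e1 : (m : ℝ) * k + 1 + s = m * (k + 1 - a) := by rw [ha]; field_simp; ring
    have e2 : r ^ (2 * k * m + 2 * m) = (r ^ m) ^ (2 * k + 2) := by rw [← pow_mul]; congr 1; ring
    simp only [hD]
    rw [e1, e2, hva]
    field_simp
    ring
  have hbounds : ∀ k : ℕ, 1 ≤ k → 1 ≤ I k * D k ∧ I k * D k ≤ 1 + (1 + 2 * A) * ((k : ℝ) ^ 2)⁻¹ := by
    intro k hk
    have hk1 : (1 : ℝ) ≤ k := by exact_mod_cast hk
    have hk0 : (0 : ℝ) < k := by linarith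
    have hy0 : 0 ≤ a * (1 - a) := mul_nonneg ha0 (by linarith)
    have hy1 : a * (1 - a) ≤ 1 := by nlinarith
    set x : ℝ := ((k : ℝ) ^ 2)⁻¹ with hx
    have hx0 : 0 < x := by positivity
    have hx1 : x ≤ 1 := inv_le_one_of_one_le₀ (one_le_pow₀ hk1)
    set y : ℝ := (k : ℝ) + 1 + a * (1 - a) / k with hy
    have hylow : (k : ℝ) + 1 ≤ y := by
      have : 0 ≤ a * (1 - a) / k := by positivity
      linarith
    have hyup : y ≤ (k + 1) * (1 + x) := by
      have h1 : a * (1 - a) / k ≤ 1 / k := by gcongr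
      have h2 : (1 : ℝ) / k = k * x := by rw [hx]; field_simp
      nlinarith
    have hinv : 1 / ((k : ℝ) + 1) ^ 2 ≤ x := by
      rw [hx, ← one_div]
      gcongr
      linarith
    rw [hDeq k hk]
    have hc : 0 ≤ m / ((r ^ m) ^ (2 * k + 2) * Real.pi) * y := by positivity
    constructor
    · calc (1 : ℝ) ≤ y / (k + 1) := by rwa [one_le_div (by positivity)]
        _ = (r ^ m) ^ (2 * k + 2) / m * (Real.pi / ((k : ℝ) + 1)) *
            (m / ((r ^ m) ^ (2 * k + 2) * Real.pi) * y) := by field_simp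
        _ ≤ _ := mul_le_mul_of_nonneg_right (hlow k) hc
    · calc _ ≤ _ := mul_le_mul_of_nonneg_right (hupp k) hc
        _ = y / (k + 1) * (1 + A * (1 / ((k : ℝ) + 1) ^ 2)) := by field_simp
        _ ≤ (1 + x) * (1 + A * x) := by
            gcongr
            rw [div_le_iff₀ (by positivity)]
            linarith
        -- As `x ≤ 1`, the term `A x²` is absorbed into a second `A x`.
        _ ≤ 1 + (1 + 2 * A) * x := by nlinarith [mul_nonneg hA hx0.le]
  -- The error is defined so that the asserted identity is exact, `I k` being `κ^(-2)`.
  refine ⟨fun k => (I k * D k)⁻¹ - 1, ?_, fun k hk => ?_⟩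
  · refine IsBigO.of_bound (1 + 2 * A) ?_
    filter_upwards [eventually_ge_atTop 1] with k hk
    obtain ⟨h1, h2⟩ := hbounds k hk
    have h3 : (I k * D k)⁻¹ ≤ 1 := inv_le_one_of_one_le₀ h1
    have h4 : 1 - (I k * D k)⁻¹ ≤ I k * D k - 1 := by
      -- The inequality `t + 1/t ≥ 2` transfers the upper bound on `I D - 1` to `1 - (I D)⁻¹`.
      have : 2 ≤ I k * D k + (I k * D k)⁻¹ := by
        have h0 : 0 < I k * D k := by linarith
        have h5 : (I k * D k) * (I k * D k)⁻¹ = 1 := mul_inv_cancel₀ h0.ne'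
        nlinarith [sq_nonneg (I k * D k - (I k * D k)⁻¹), inv_pos.mpr h0]
      linarith
    rw [Real.norm_of_nonneg (by positivity : (0 : ℝ) ≤ ((k : ℝ) ^ 2)⁻¹), Real.norm_eq_abs,
      abs_of_nonpos (by linarith)]
    linarith
  · rw [OrthPoly.kappa_sq]
    have hD0 : D k ≠ 0 := by
      intro h
      have := (hbounds k hk).1
      rw [h, mul_zero] at this
      linarith
    congr 1
    change (I k)⁻¹ = D k * (1 + ((I k * D k)⁻¹ - 1))
    rw [add_sub_cancel, mul_inv, mul_left_comm, mul_inv_cancel₀ hD0, mul_one]
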